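/- Let $L^2=L^2(0,1)$ with inner product $(f,g)=\int_0^1 f\bar g\,dx$ and norm $\|\cdot\|$. For a $1$-periodic $g$ let $\widehat g(k)=\int_0^1 g(x)e^{-2\pi i kx}\,dx$, and let $H^\mu$ be the space of real $1$-periodic functions with $\|g\|_\mu=\big(\sum_{k\in\mathbb Z}(1+k^2)^\mu|\widehat g(k)|^2\big)^{1/2}<\infty$. For an integer $N\ge 1$ let $S_N=\mathrm{span}\{e^{2\pi i kx}: -N\le k\le N\}$, and let $P$ be the $L^2$-projection onto $S_N$. Let $\kappa_1,\kappa_2>0$, $\lambda\in\mathbb R$, $a<0$, $b>0$, $T>0$ and $\mu>3/2$. (In the internal-wave model with density ratio $\gamma$ and depth ratio $\delta$, $\kappa_1=\frac1{\delta+\gamma}$, $\kappa_2=1-\gamma$, $\lambda=\frac{\delta^2-\gamma}{(\delta+\gamma)^2}$.) Suppose that $\zeta,u\in C^1([0,T];H^\mu)$ solve, in the sense of periodic distributions in $x$ for every $t\in[0,T]$, the Boussinesq system with $c=d=0$, $$\zeta_t+\kappa_1u_x+\lambda(\zeta u)_x+au_{xxx}-b\zeta_{xxt}=0,\qquad u_t+\kappa_2\zeta_x+\lambda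 uu_x=0,$$ with $\zeta(0)=\zeta_0$, $u(0)=u_0$. With $\mathcal T_b=(I-b\partial_x^2)^{-1}$, the first equation is equivalent to $\zeta_t-\frac ab u_x+(\kappa_1+\frac ab)\mathcal T_bu_x+\lambda\mathcal T_b(\zeta u)_x=0$, and the system is semidiscretized in this form: find real-valued $\zeta_N,u_N:[0,T]\to S_N$ such that, for all $t\in[0,T]$ and all $\varphi,\chi\in S_N$, $$(\zeta_{Nt},\varphi)-\tfrac ab(u_{Nx},\varphi)+(\kappa_1+\tfrac ab)(\mathcal T_bu_{Nx},\varphi)+\lambda(\mathcal T_b(\zeta_Nu_N)_x,\varphi)=0,$$ $$(u_{Nt},\chi)+\kappa_2(\zeta_{Nx},\chi)+\lambda(u_Nu_{Nx},\chi)=0,$$ with $\zeta_N(0)=P\zeta_0$, $u_N(0)=Pu_0$. Then, for every $N\ge 1$, there is at most one solution $(\zeta_N,u_N)$ of the semidiscrete problem on $[0,T]$; for all sufficiently large $N$ such a solution exists; and there is a constant $C$, independent of $N$, such that for every $N\ge1$ for which the solution exists on $[0,T]$, $$\max_{0\le t\le T}\big(\|\zeta_N-\zeta\|+\|u_N-u\|\big)\le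 C\,N^{1-\mu}.$$ -/

import Mathlib

open MeasureTheory Set

noncomputable section

namespace PeriodicBoussinesq

/-- The `k`-th Fourier coefficient `∫₀¹ g(x) e^{-2πikx} dx` of a real function on `ℝ/ℤ`. -/
def coeff (g : UnitAddCircle → ℝ) (k : ℤ) : ℂ :=
  fourierCoeff (fun x => (g x : ℂ)) k

/-- The complexification of a real `L²` function. -/
def complexify : Lp ℝ 2 (AddCircle.haarAddCircle (T := 1)) →L[ℝ]
    Lp ℂ 2 (AddCircle.haarAddCircle (T := 1)) :=
  Complex.ofRealCLM.compLpL 2 AddCircle.haarAddCircle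

theorem complexify_repr (g : Lp ℝ 2 (AddCircle.haarAddCircle (T := 1))) (k : ℤ) :
    fourierBasis.repr (complexify g) k = coeff g k := by
  rw [fourierBasis_repr]
  unfold coeff fourierCoeff
  apply integral_congr_ae
  filter_upwards [ContinuousLinearMap.coeFn_compLpL (p := 2)
    (μ := AddCircle.haarAddCircle (T := 1)) Complex.ofRealCLM g] with x hx
  unfold complexify
  rw [hx]
  rfl

theorem coeff_add (f g : Lp ℝ 2 (AddCircle.haarAddCircle (T := 1))) (k : ℤ) :
    coeff (f + g : Lp ℝ 2 (AddCircle.haarAddCircle (T := 1))) k = coeff f k + coeff g k := by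
  simp only [← complexify_repr, map_add, lp.coeFn_add, Pi.add_apply]

theorem coeff_smul (c : ℝ) (g : Lp ℝ 2 (AddCircle.haarAddCircle (T := 1))) (k : ℤ) :
    coeff (c • g : Lp ℝ 2 (AddCircle.haarAddCircle (T := 1))) k = (c : ℂ) * coeff g k := by
  have h : complexify (c • g) = (c : ℂ) • complexify g := by
    rw [map_smul]
    exact (Complex.coe_smul c _).symm
  rw [← complexify_repr, h, map_smul, lp.coeFn_smul, Pi.smul_apply, complexify_repr, smul_eq_mul]

theorem coeff_injective {g : Lp ℝ 2 (AddCircle.haarAddCircle (T := 1))}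
    (h : ∀ k, coeff g k = 0) : g = 0 := by
  have h1 : complexify g = 0 := by
    apply fourierBasis.repr.injective
    rw [map_zero]
    ext k
    rw [complexify_repr, h k]
    rfl
  have h2 := ContinuousLinearMap.coeFn_compLpL (p := 2)
    (μ := AddCircle.haarAddCircle (T := 1)) Complex.ofRealCLM g
  have h3 := Lp.coeFn_zero ℂ 2 (AddCircle.haarAddCircle (T := 1))
  rw [← h1] at h3
  apply Lp.ext
  filter_upwards [h2, h3, Lp.coeFn_zero ℝ 2 (AddCircle.haarAddCircle (T := 1))] with x e2 e3 e4
  rw [e4]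
  unfold complexify at e3
  rw [e2] at e3
  simpa using e3

/-- The Fourier coefficients with the Bessel weight `(1+k²)^{μ/2}`. -/
def weighted (μ : ℝ) (g : UnitAddCircle → ℝ) (k : ℤ) : ℂ :=
  (((1 + (k : ℝ) ^ 2) ^ (μ / 2) : ℝ) : ℂ) * coeff g k

theorem norm_weighted_sq (μ : ℝ) (g : UnitAddCircle → ℝ) (k : ℤ) :
    ‖weighted μ g k‖ ^ 2 = (1 + (k : ℝ) ^ 2) ^ μ * ‖coeff g k‖ ^ 2 := by
  have hk : (0 : ℝ) ≤ 1 + (k : ℝ) ^ 2 := by positivity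
  rw [weighted, norm_mul, mul_pow, Complex.norm_real, Real.norm_eq_abs,
    abs_of_nonneg (Real.rpow_nonneg hk _), ← Real.rpow_natCast, ← Real.rpow_mul hk]
  norm_num

theorem memℓp_weighted_iff (μ : ℝ) (g : UnitAddCircle → ℝ) :
    Memℓp (weighted μ g) 2 ↔
      Summable fun k : ℤ => (1 + (k : ℝ) ^ 2) ^ μ * ‖coeff g k‖ ^ 2 := by
  rw [memℓp_gen_iff (by norm_num)]
  refine summable_congr fun k => ?_
  rw [← norm_weighted_sq]
  norm_num

theorem weighted_add (μ : ℝ) (f g : Lp ℝ 2 (AddCircle.haarAddCircle (T := 1))) :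
    weighted μ (f + g : Lp ℝ 2 (AddCircle.haarAddCircle (T := 1)))
      = weighted μ f + weighted μ g := by
  funext k
  simp only [weighted, Pi.add_apply, coeff_add, mul_add]

theorem weighted_smul (μ c : ℝ) (g : Lp ℝ 2 (AddCircle.haarAddCircle (T := 1))) :
    weighted μ (c • g : Lp ℝ 2 (AddCircle.haarAddCircle (T := 1))) = c • weighted μ g := by
  funext k
  simp only [weighted, Pi.smul_apply, coeff_smul, Complex.real_smul]
  ring

/-- The real `L²` functions `g` on `ℝ/ℤ` with `∑ (1+k²)^μ |ĝ(k)|² < ∞`. -/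
def sobolevSubmodule (μ : ℝ) : Submodule ℝ (Lp ℝ 2 (AddCircle.haarAddCircle (T := 1))) where
  carrier := {g | Summable fun k : ℤ => (1 + (k : ℝ) ^ 2) ^ μ * ‖coeff g k‖ ^ 2}
  add_mem' := by
    intro f g hf hg
    have hf' := (memℓp_weighted_iff μ f).2 hf
    have hg' := (memℓp_weighted_iff μ g).2 hg
    have h := hf'.add hg'
    rw [← weighted_add] at h
    exact (memℓp_weighted_iff μ _).1 h
  zero_mem' := by
    have h : ∀ k, coeff (0 : Lp ℝ 2 (AddCircle.haarAddCircle (T := 1))) k = 0 := fun k => by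
      rw [← complexify_repr, map_zero, map_zero]
      rfl
    change Summable fun k : ℤ => (1 + (k : ℝ) ^ 2) ^ μ *
      ‖coeff (0 : Lp ℝ 2 (AddCircle.haarAddCircle (T := 1))) k‖ ^ 2
    simp only [h]
    simp
  smul_mem' := by
    intro c g hg
    have hg' := (memℓp_weighted_iff μ g).2 hg
    have h := hg'.const_smul c
    rw [← weighted_smul] at h
    exact (memℓp_weighted_iff μ _).1 h

/-- The periodic Sobolev space `H^μ` of real functions on `ℝ/ℤ`. It is a type of its own, so that
it carries the `H^μ` norm (see `PerSobolev.norm_eq`) and not the `L²` norm. -/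
def PerSobolev (μ : ℝ) : Type := sobolevSubmodule μ

namespace PerSobolev

variable {μ : ℝ}

instance : AddCommGroup (PerSobolev μ) := inferInstanceAs (AddCommGroup (sobolevSubmodule μ))

instance : Module ℝ (PerSobolev μ) := inferInstanceAs (Module ℝ (sobolevSubmodule μ))

/-- The underlying `L²` function. -/
def toL2 (g : PerSobolev μ) : Lp ℝ 2 (AddCircle.haarAddCircle (T := 1)) := Subtype.val g

instance : CoeFun (PerSobolev μ) (fun _ => UnitAddCircle → ℝ) := ⟨fun g => g.toL2⟩

/-- The embedding of `H^μ` into `ℓ²(ℤ)` by weighted Fourier coefficients. -/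
def toEll2 (μ : ℝ) : PerSobolev μ →ₗ[ℝ] lp (fun _ : ℤ => ℂ) 2 where
  toFun g := ⟨weighted μ g, (memℓp_weighted_iff μ g).2 g.2⟩
  map_add' f g := Subtype.ext (weighted_add μ f.toL2 g.toL2)
  map_smul' c g := Subtype.ext (weighted_smul μ c g.toL2)

theorem toEll2_injective : Function.Injective (toEll2 μ) := by
  rw [← LinearMap.ker_eq_bot, LinearMap.ker_eq_bot']
  intro g hg
  refine Subtype.ext (coeff_injective (g := g.toL2) fun k => ?_)
  have h : weighted μ g k = 0 := by
    have := congrArg (fun F : lp (fun _ : ℤ => ℂ) 2 => F k) hg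
    exact this
  have hk : (0 : ℝ) < (1 + (k : ℝ) ^ 2) ^ (μ / 2) := by positivity
  rcases mul_eq_zero.1 h with h | h
  · exact absurd (Complex.ofReal_eq_zero.1 h) hk.ne'
  · exact h

instance : NormedAddCommGroup (PerSobolev μ) :=
  NormedAddCommGroup.induced (PerSobolev μ) (lp (fun _ : ℤ => ℂ) 2) (toEll2 μ) toEll2_injective

instance : NormedSpace ℝ (PerSobolev μ) := NormedSpace.induced ℝ _ _ (toEll2 μ)

/-- `‖g‖_μ = (∑ (1+k²)^μ |ĝ(k)|²)^{1/2}`. -/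
theorem norm_eq (g : PerSobolev μ) :
    ‖g‖ = Real.sqrt (∑' k : ℤ, (1 + (k : ℝ) ^ 2) ^ μ * ‖coeff g k‖ ^ 2) := by
  have h : ‖g‖ = ‖toEll2 μ g‖ := rfl
  have h2 := lp.norm_rpow_eq_tsum (p := 2) (by norm_num) (toEll2 μ g)
  simp only [ENNReal.toReal_ofNat, Real.rpow_ofNat] at h2
  rw [h, ← Real.sqrt_sq (norm_nonneg _), h2]
  congr 1
  exact tsum_congr fun k => norm_weighted_sq μ g k

end PerSobolev

/-- The derivative `f_x` of a function on `ℝ/ℤ`. -/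
def dx {E : Type*} [NormedAddCommGroup E] [NormedSpace ℝ E] (f : UnitAddCircle → E) :
    UnitAddCircle → E :=
  fun x => deriv (fun h : ℝ => f (x + (h : UnitAddCircle))) 0

/-- `∫₀¹ f(x) dx`: normalised Haar measure on `ℝ/ℤ` is Lebesgue measure on `[0,1)`. -/
def mean (f : UnitAddCircle → ℝ) : ℝ := ∫ x, f x ∂AddCircle.haarAddCircle

/-- `ζ, u : [0,T] → H^μ` satisfy, at every `t ∈ [0,T]` and in the sense of periodic distributions,
`ζ_t + κ₁ u_x + lam (ζ u)_x + a u_xxx - b ζ_xxt = 0` and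
`u_t + κ₂ ζ_x + lam u u_x + c ζ_xxx - d u_xxt = 0`: all `x`-derivatives are moved to a smooth
periodic test function `φ`, with `u u_x = (u²)_x / 2`. Time derivatives are taken in `H^μ`. -/
def IsSolution (κ₁ κ₂ lam a b c d T : ℝ) {μ : ℝ} (ζ u : ℝ → PerSobolev μ) : Prop :=
  ∀ t ∈ Icc (0 : ℝ) T, ∀ φ : UnitAddCircle → ℝ,
    ContDiff ℝ (⊤ : ℕ∞) (fun y : ℝ => φ (y : UnitAddCircle)) →
    (mean (fun x => (derivWithin ζ (Icc 0 T) t) x * φ x)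
        - κ₁ * mean (fun x => u t x * dx φ x)
        - lam * mean (fun x => ζ t x * u t x * dx φ x)
        - a * mean (fun x => u t x * dx (dx (dx φ)) x)
        - b * mean (fun x => (derivWithin ζ (Icc 0 T) t) x * dx (dx φ) x) = 0) ∧
    (mean (fun x => (derivWithin u (Icc 0 T) t) x * φ x)
        - κ₂ * mean (fun x => ζ t x * dx φ x)
        - lam / 2 * mean (fun x => u t x ^ 2 * dx φ x)
        - c * mean (fun x => ζ t x * dx (dx (dx φ)) x)
        - d * mean (fun x => (derivWithin u (Icc 0 T) t) x * dx (dx φ) x) = 0)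

/-- `S_N = span {e^{2πikx} : -N ≤ k ≤ N}`. -/
def S (N : ℕ) : Submodule ℂ C(UnitAddCircle, ℂ) :=
  Submodule.span ℂ ((fun k : ℤ => (fourier k : C(UnitAddCircle, ℂ))) '' Icc (-(N : ℤ)) N)

/-- The `L²`-projection onto `S_N`, `P v = ∑_{|k| ≤ N} v̂(k) e^{2πikx}`. -/
def proj (N : ℕ) (v : UnitAddCircle → ℝ) : C(UnitAddCircle, ℂ) :=
  ∑ k ∈ Finset.Icc (-(N : ℤ)) N, coeff v k • (fourier k : C(UnitAddCircle, ℂ))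

/-- `T_b = (I - b ∂_x²)⁻¹` on periodic functions, in its Fourier representation: the mode
`e^{2πikx}` is divided by `1 + b (2πk)²`. -/
def Tinv (b : ℝ) (f : UnitAddCircle → ℂ) : UnitAddCircle → ℂ :=
  fun x => ∑' k : ℤ, fourierCoeff f k / (((1 + b * (2 * Real.pi * k) ^ 2 : ℝ)) : ℂ) * fourier k x

/-- The `L²` inner product `(f, g) = ∫₀¹ f(x) \overline{g(x)} dx`. -/
def ip (f g : UnitAddCircle → ℂ) : ℂ :=
  ∫ x, f x * (starRingEnd ℂ) (g x) ∂AddCircle.haarAddCircle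

/-- The `L²` norm `(∫₀¹ |f(x)|² dx)^{1/2}`. -/
def l2norm (f : UnitAddCircle → ℂ) : ℝ :=
  Real.sqrt (∫ x, ‖f x‖ ^ 2 ∂AddCircle.haarAddCircle)

/-- `ζN, uN : [0,T] → S_N` are real valued, differentiable in time and solve the spectral Galerkin
semidiscretization of `ζ_t - (a/b) u_x + (κ₁ + a/b) T_b u_x + lam T_b (ζ u)_x = 0`,
`u_t + κ₂ ζ_x + lam u u_x = 0` with initial values `P ζ₀`, `P u₀`. -/
structure IsSemidiscreteSolution (κ₁ κ₂ lam a b T : ℝ) (ζ₀ u₀ : UnitAddCircle → ℝ) (N : ℕ)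
    (ζN uN : ℝ → C(UnitAddCircle, ℂ)) : Prop where
  mem_S : ∀ t ∈ Icc (0 : ℝ) T, ζN t ∈ S N ∧ uN t ∈ S N
  real_valued : ∀ t ∈ Icc (0 : ℝ) T, ∀ x, (ζN t x).im = 0 ∧ (uN t x).im = 0
  differentiable : DifferentiableOn ℝ ζN (Icc 0 T) ∧ DifferentiableOn ℝ uN (Icc 0 T)
  eq_ζ : ∀ t ∈ Icc (0 : ℝ) T, ∀ φ ∈ S N,
    ip (⇑(derivWithin ζN (Icc 0 T) t)) φ
      - (a / b : ℝ) * ip (dx (uN t)) φ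
      + (κ₁ + a / b : ℝ) * ip (Tinv b (dx (uN t))) φ
      + lam * ip (Tinv b (dx (fun x => ζN t x * uN t x))) φ = 0
  eq_u : ∀ t ∈ Icc (0 : ℝ) T, ∀ χ ∈ S N,
    ip (⇑(derivWithin uN (Icc 0 T) t)) χ
      + κ₂ * ip (dx (ζN t)) χ
      + lam * ip (fun x => uN t x * dx (uN t) x) χ = 0
  initial : ζN 0 = proj N ζ₀ ∧ uN 0 = proj N u₀

end PeriodicBoussinesq

end

namespace PeriodicBoussinesq

/-! The argument is an energy estimate carried out entirely on Fourier coefficients. The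
semidiscrete problem is a finite system of ordinary differential equations for the modes `|k| ≤ N`
(`IsModeSolution`). The exact coefficients satisfy the same equations, `fieldZ` and `fieldU`, for
every `k` (`IsSolution.coeff_eq`). Write `θ` and `ξ` for the differences between the discrete
solution and the truncated exact one. The projection error is `O(N^{1-μ})` by `SobBd.tail`, so only
`θ, ξ` have to be estimated.

The energy is `κ₂ ‖θ‖² + α ‖ξ‖²` with `α = -a/b > 0`. With these weights the first-order terms
`(a/b) ξ_x` and `-κ₂ θ_x` cancel, since `∂_x` is skew-adjoint (`re_dsym_cross`). Every other term of
the first equation carries `T_b ∂_x`, whose symbol is square summable (`exists_msym_bound`);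
products therefore need only a sup bound on their coefficients, and `ℓ² * ℓ² ⊂ ℓ^∞` supplies it.

In the second equation the loss of a derivative in `u u_x` is repaired by integration by parts: the
cubic term `∫ (ξ²)_x ξ` vanishes (`re_cubic_eq_zero`), and `2 ∫ (ξ v)_x ξ = ∫ v_x ξ²` for the
truncated solution `v` (`two_mul_re_commutator`). The latter is controlled by the `ℓ¹` norm of the
coefficients of `v_x`, finite because `μ > 3/2` (`exists_weight_l1`). What remains contains the tail
of `u` and is `O(N^{1-μ}) ‖ξ‖`.

Thus `E' ≤ K (E + N^{2(1-μ)})` as long as `E ≤ 1` (`exists_energy_estimate`), with `E(0) = 0`. For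
large `N` a barrier argument (`le_of_deriv_le_of_le_one`) keeps `E` of size `N^{2(1-μ)}`, hence
below one. The same bound gives existence: a cut-off system has a global solution, and the cut-off
is inactive while `E ≤ 1` (`exists_isModeSolution`). The finitely many remaining `N` are absorbed in
the constant, using uniqueness. -/

/-! ### Trigonometric polynomials and convolution -/

/-- The symbol `2πik` of the derivative. -/
noncomputable def dsym (k : ℤ) : ℂ := 2 * Real.pi * k * Complex.I

/-- The symbol of `T_b`. -/
noncomputable def msym (b : ℝ) (k : ℤ) : ℂ := 1 / (((1 + b * (2 * Real.pi * k) ^ 2 : ℝ)) : ℂ)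

/-- Convolution of sequences. -/
noncomputable def conv (a b : ℤ → ℂ) (k : ℤ) : ℂ := ∑' j, a j * b (k - j)

/-- The trigonometric polynomial `∑_{|k| ≤ N} c_k e^{2πikx}`. -/
noncomputable def tp (N : ℕ) (c : ℤ → ℂ) : C(UnitAddCircle, ℂ) :=
  ∑ k ∈ Finset.Icc (-(N : ℤ)) N, c k • (fourier k : C(UnitAddCircle, ℂ))

theorem tp_apply (N : ℕ) (c : ℤ → ℂ) (x : UnitAddCircle) :
    tp N c x = ∑ k ∈ Finset.Icc (-(N : ℤ)) N, c k * fourier k x := by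
  simp [tp, ContinuousMap.sum_apply]

theorem tp_congr {N : ℕ} {c c' : ℤ → ℂ} (h : ∀ k ∈ Finset.Icc (-(N : ℤ)) N, c k = c' k) :
    tp N c = tp N c' :=
  Finset.sum_congr rfl fun k hk => by rw [h k hk]

theorem tp_add (N : ℕ) (c c' : ℤ → ℂ) : tp N (c + c') = tp N c + tp N c' := by
  ext x
  simp [tp_apply, add_mul, Finset.sum_add_distrib]

theorem tp_smul (N : ℕ) (r : ℂ) (c : ℤ → ℂ) : tp N (r • c) = r • tp N c := by
  simp [tp, Finset.smul_sum, mul_smul]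

theorem tp_mem (N : ℕ) (c : ℤ → ℂ) : tp N c ∈ S N :=
  Submodule.sum_mem _ fun k hk => Submodule.smul_mem _ _
    (Submodule.subset_span ⟨k, by simpa using hk, rfl⟩)

theorem tp_single {N : ℕ} {k : ℤ} (hk : k ∈ Finset.Icc (-(N : ℤ)) N) :
    tp N (Pi.single k 1) = fourier k := by
  rw [tp, Finset.sum_eq_single k]
  · simp
  · intro j _ hj; ext x; simp [hj]
  · intro h; exact absurd hk h

theorem integrable_continuousMap (f : C(UnitAddCircle, ℂ)) :
    Integrable f (AddCircle.haarAddCircle (T := 1)) :=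
  f.continuous.integrable_of_hasCompactSupport (HasCompactSupport.of_compactSpace _)

theorem memLp_continuousMap (f : C(UnitAddCircle, ℂ)) :
    MemLp f 2 (AddCircle.haarAddCircle (T := 1)) :=
  f.continuous.memLp_of_hasCompactSupport (HasCompactSupport.of_compactSpace _)

theorem fourierCoeff_tp (N : ℕ) (c : ℤ → ℂ) (k : ℤ) :
    fourierCoeff (tp N c) k = if k ∈ Finset.Icc (-(N : ℤ)) N then c k else 0 := by
  have h : (tp N c : UnitAddCircle → ℂ)
      = ∑ j ∈ Finset.Icc (-(N : ℤ)) N, (c j • (fourier j : C(UnitAddCircle, ℂ)) : UnitAddCircle → ℂ) := by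
    funext x; simp [tp_apply]
  rw [h, fourierCoeff.sum]
  · simp only [Finset.sum_apply]
    have : ∀ j, fourierCoeff (c j • ⇑(fourier j : C(UnitAddCircle, ℂ))) k
        = if k = j then c j else 0 := by
      intro j
      have h2 := fourierCoeff.const_smul (T := 1) (⇑(fourier j : C(UnitAddCircle, ℂ))) (c j) k
      have h3 : fourierCoeff (⇑(fourier j : C(UnitAddCircle, ℂ))) k = (Pi.single j 1 : ℤ → ℂ) k := by
        rw [fourierCoeff_fourier]
      rw [h2, h3]
      by_cases hkj : k = j
      · subst hkj; simp
      · simp [hkj]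
    simp only [this]
    simp
  · intro j _
    exact (integrable_continuousMap (fourier j)).smul (c j)

theorem eq_tp_of_mem {N : ℕ} {f : C(UnitAddCircle, ℂ)} (hf : f ∈ S N) :
    f = tp N (fourierCoeff f) := by
  have h : ∃ c, f = tp N c := by
    induction hf using Submodule.span_induction with
    | mem x hx =>
      obtain ⟨k, hk, rfl⟩ := hx
      exact ⟨_, (tp_single (by simpa using hk)).symm⟩
    | zero => exact ⟨0, by ext x; simp [tp_apply]⟩
    | add x y _ _ hx hy =>
      obtain ⟨c, rfl⟩ := hx
      obtain ⟨c', rfl⟩ := hy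
      exact ⟨c + c', (tp_add _ _ _).symm⟩
    | smul r x _ hx =>
      obtain ⟨c, rfl⟩ := hx
      exact ⟨r • c, (tp_smul _ _ _).symm⟩
  obtain ⟨c, rfl⟩ := h
  refine tp_congr fun k hk => ?_
  rw [fourierCoeff_tp, if_pos hk]

theorem fourierCoeff_eq_zero_of_mem {N : ℕ} {f : C(UnitAddCircle, ℂ)} (hf : f ∈ S N) {k : ℤ}
    (hk : k ∉ Finset.Icc (-(N : ℤ)) N) : fourierCoeff f k = 0 := by
  rw [eq_tp_of_mem hf, fourierCoeff_tp, if_neg hk]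

theorem mul_mem_S {N M : ℕ} {f g : C(UnitAddCircle, ℂ)} (hf : f ∈ S N) (hg : g ∈ S M) :
    f * g ∈ S (N + M) := by
  have h : f * g ∈ S N * S M := Submodule.mul_mem_mul hf hg
  unfold S at h
  rw [Submodule.span_mul_span] at h
  refine Submodule.span_mono ?_ h
  rintro _ ⟨_, ⟨j, hj, rfl⟩, _, ⟨k, hk, rfl⟩, rfl⟩
  refine ⟨j + k, ?_, ?_⟩
  · simp only [mem_Icc] at *
    push_cast
    omega
  · ext x
    simp only [ContinuousMap.mul_apply]
    exact fourier_add

theorem hasDerivAt_fourier_shift (k : ℤ) (x : UnitAddCircle) :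
    HasDerivAt (fun h : ℝ => (fourier k (x + (h : UnitAddCircle)) : ℂ)) (dsym k * fourier k x) 0 := by
  induction x using QuotientAddGroup.induction_on with
  | H y =>
    have h1 := hasDerivAt_fourier (1 : ℝ) k (y + 0)
    have h2 := HasDerivAt.comp_const_add (f := fun y : ℝ => (fourier k (y : UnitAddCircle) : ℂ)) y 0 h1
    have h3 : dsym k * fourier k ((y : ℝ) : UnitAddCircle)
        = 2 * Real.pi * Complex.I * k / (1 : ℝ) * fourier k ((y + 0 : ℝ) : UnitAddCircle) := by
      simp [dsym]; ring
    change HasDerivAt (fun h : ℝ => (fourier k (((y : ℝ) : UnitAddCircle) + (h : UnitAddCircle)) : ℂ))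
      (dsym k * fourier k ((y : ℝ) : UnitAddCircle)) 0
    rw [h3]
    simpa using h2

theorem hasDerivAt_tp_shift (N : ℕ) (c : ℤ → ℂ) (x : UnitAddCircle) :
    HasDerivAt (fun h : ℝ => tp N c (x + (h : UnitAddCircle)))
      (tp N (fun k => dsym k * c k) x) 0 := by
  simp only [tp_apply]
  have := HasDerivAt.fun_sum (u := Finset.Icc (-(N : ℤ)) N)
    (fun k _ => (hasDerivAt_fourier_shift k x).const_mul (c k))
  have e : ∑ k ∈ Finset.Icc (-(N : ℤ)) N, dsym k * c k * fourier k x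
      = ∑ k ∈ Finset.Icc (-(N : ℤ)) N, c k * (dsym k * fourier k x) :=
    Finset.sum_congr rfl fun k _ => by ring
  rw [e]
  exact this

theorem dx_tp (N : ℕ) (c : ℤ → ℂ) : dx (tp N c) = tp N (fun k => dsym k * c k) := by
  funext x
  exact (hasDerivAt_tp_shift N c x).deriv

theorem dx_of_mem {N : ℕ} {f : C(UnitAddCircle, ℂ)} (hf : f ∈ S N) :
    dx f = tp N (fun k => dsym k * fourierCoeff f k) := by
  conv_lhs => rw [eq_tp_of_mem hf]
  exact dx_tp _ _

/-- The identity `f f_x = (f²)_x / 2` puts the nonlinearity in conservation form. The degree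
doubles; pairing with `S N` later discards the additional modes. -/
theorem mul_dx_self {N : ℕ} {f : C(UnitAddCircle, ℂ)} (hf : f ∈ S N) :
    (fun x => f x * dx f x) = tp (N + N) (fun k => 1 / 2 * (dsym k * fourierCoeff (f * f : C(UnitAddCircle, ℂ)) k)) := by
  have h1 : dx (f * f : C(UnitAddCircle, ℂ)) = fun x => 2 * (f x * dx f x) := by
    funext x
    have h := hasDerivAt_tp_shift N (fourierCoeff f) x
    rw [← eq_tp_of_mem hf, ← dx_of_mem hf] at h
    have h2 := h.mul h
    have h3 : dx (f * f : C(UnitAddCircle, ℂ)) x = _ := h2.deriv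
    rw [h3]
    simp; ring
  have h2 : (fun k => 1 / 2 * (dsym k * fourierCoeff (f * f : C(UnitAddCircle, ℂ)) k))
    = (1 / 2 : ℂ) • fun k => dsym k * fourierCoeff (f * f : C(UnitAddCircle, ℂ)) k := rfl
  rw [h2, tp_smul]
  funext x
  rw [ContinuousMap.smul_apply, ← dx_of_mem (mul_mem_S hf hf), h1]
  simp

theorem Tinv_tp (b : ℝ) (N : ℕ) (c : ℤ → ℂ) : Tinv b (tp N c) = tp N (fun k => msym b k * c k) := by
  funext x
  unfold Tinv
  rw [tsum_eq_sum (s := Finset.Icc (-(N : ℤ)) N), tp_apply]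
  · refine Finset.sum_congr rfl fun k hk => ?_
    rw [fourierCoeff_tp, if_pos hk, msym]
    ring
  · intro k hk
    rw [fourierCoeff_tp, if_neg hk]
    simp

theorem ip_fourier (f : UnitAddCircle → ℂ) (k : ℤ) : ip f (fourier k : C(UnitAddCircle, ℂ)) = fourierCoeff f k := by
  unfold ip fourierCoeff
  refine integral_congr_ae (Filter.Eventually.of_forall fun x => ?_)
  simp only [fourier_neg, smul_eq_mul]
  ring

/-- Only the modes of `φ` enter, so testing against `S N` performs the Galerkin projection without
any explicit projector. -/
theorem ip_eq_sum (f : C(UnitAddCircle, ℂ)) {N : ℕ} {φ : C(UnitAddCircle, ℂ)} (hφ : φ ∈ S N) :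
    ip f φ = ∑ k ∈ Finset.Icc (-(N : ℤ)) N,
      fourierCoeff f k * (starRingEnd ℂ) (fourierCoeff φ k) := by
  simp only [← ip_fourier f]
  conv_lhs => rw [eq_tp_of_mem hφ]
  unfold ip
  simp only [← integral_mul_const]
  rw [← integral_finsetSum]
  · refine integral_congr_ae (Filter.Eventually.of_forall fun x => ?_)
    simp only [tp_apply, map_sum, Finset.mul_sum, map_mul]
    exact Finset.sum_congr rfl fun k _ => by ring
  · intro k _
    have := integrable_continuousMap (f * star (fourier k : C(UnitAddCircle, ℂ)))
    exact this.mul_const _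

/-- Parseval for the pair `f` and `conj g · e^{2πikx}`; square integrability of both factors is
enough. -/
theorem hasSum_fourierCoeff_mul {f g : UnitAddCircle → ℂ}
    (hf : MemLp f 2 (AddCircle.haarAddCircle (T := 1)))
    (hg : MemLp g 2 (AddCircle.haarAddCircle (T := 1))) (k : ℤ) :
    HasSum (fun j => fourierCoeff f j * fourierCoeff g (k - j))
      (fourierCoeff (fun x => f x * g x) k) := by
  have hG : MemLp (fun x => (starRingEnd ℂ) (g x) * fourier k x) 2
      (AddCircle.haarAddCircle (T := 1)) := by
    have h := (memLp_continuousMap (fourier k : C(UnitAddCircle, ℂ)))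
    refine hg.of_le ?_ ?_
    · exact (Complex.continuous_conj.comp_aestronglyMeasurable hg.1).mul h.1
    · refine Filter.Eventually.of_forall fun x => ?_
      rw [norm_mul, RCLike.norm_conj, fourier_apply, Circle.norm_coe, mul_one]
  have h := fourierBasis.hasSum_inner_mul_inner (hG.toLp _) (hf.toLp _)
  have e1 : ∀ j, inner ℂ (fourierBasis j) (hf.toLp _) = fourierCoeff f j := by
    intro j
    rw [← fourierBasis.repr_apply_apply, fourierBasis_repr]
    rw [fourierCoeff_congr_ae hf.coeFn_toLp]
  have e2 : ∀ j, inner ℂ (hG.toLp _) (fourierBasis j) = fourierCoeff g (k - j) := by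
    intro j
    rw [← inner_conj_symm, ← fourierBasis.repr_apply_apply, fourierBasis_repr,
      fourierCoeff_congr_ae hG.coeFn_toLp]
    unfold fourierCoeff
    rw [← integral_conj]
    refine integral_congr_ae (Filter.Eventually.of_forall fun x => ?_)
    simp only [smul_eq_mul, map_mul, Complex.conj_conj]
    rw [← fourier_neg, ← fourier_neg, neg_neg, neg_sub, sub_eq_add_neg, fourier_add]
    ring
  have e3 : inner ℂ (hG.toLp _) (hf.toLp _) = fourierCoeff (fun x => f x * g x) k := by
    rw [L2.inner_def]
    unfold fourierCoeff
    refine integral_congr_ae ?_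
    filter_upwards [hf.coeFn_toLp, hG.coeFn_toLp] with x h1 h2
    rw [h1, h2]
    simp only [RCLike.inner_apply, map_mul, Complex.conj_conj, fourier_neg, smul_eq_mul]
    ring
  simp only [e1, e2, e3] at h
  simpa only [mul_comm] using h

theorem fourierCoeff_mul_eq_conv {f g : UnitAddCircle → ℂ}
    (hf : MemLp f 2 (AddCircle.haarAddCircle (T := 1)))
    (hg : MemLp g 2 (AddCircle.haarAddCircle (T := 1))) (k : ℤ) :
    fourierCoeff (fun x => f x * g x) k = conv (fourierCoeff f) (fourierCoeff g) k :=
  (hasSum_fourierCoeff_mul hf hg k).tsum_eq.symm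

/-! ### The Fourier coefficients of the exact solution -/

/-- The `k`-th mode of the right hand side of the first equation. -/
noncomputable def fieldZ (κ₁ lam a b : ℝ) (z u : ℤ → ℂ) (k : ℤ) : ℂ :=
  (a / b : ℝ) * (dsym k * u k) - (κ₁ + a / b : ℝ) * (msym b k * (dsym k * u k))
    - lam * (msym b k * (dsym k * conv z u k))

/-- The `k`-th mode of the right hand side of the second equation. -/
noncomputable def fieldU (κ₂ lam : ℝ) (z u : ℤ → ℂ) (k : ℤ) : ℂ :=
  -(κ₂ * (dsym k * z k)) - lam * (1 / 2 * (dsym k * conv u u k))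

theorem dsym_neg (k : ℤ) : dsym (-k) = -dsym k := by simp [dsym]

/-- The real trigonometric function `Re (c e^{-2πikx})`. -/
noncomputable def testFun (c : ℂ) (k : ℤ) (x : UnitAddCircle) : ℝ := (c * fourier (-k) x).re

theorem contDiff_testFun (c : ℂ) (k : ℤ) :
    ContDiff ℝ (⊤ : ℕ∞) (fun y : ℝ => testFun c k (y : UnitAddCircle)) := by
  unfold testFun
  refine Complex.reCLM.contDiff.comp (contDiff_const.mul ?_)
  simp only [fourier_coe_apply]
  have h : ContDiff ℝ (⊤ : ℕ∞) fun y : ℝ => (y : ℂ) := Complex.ofRealCLM.contDiff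
  exact ((contDiff_const.mul h).div_const _).cexp

theorem dx_testFun (c : ℂ) (k : ℤ) : dx (testFun c k) = testFun (-(c * dsym k)) k := by
  funext x
  have h := (hasDerivAt_fourier_shift (-k) x).const_mul c
  have h2 := (Complex.reCLM.hasFDerivAt (x := c * fourier (-k) (x + ((0 : ℝ) : UnitAddCircle)))).comp_hasDerivAt 0 h
  have h3 : dx (testFun c k) x = _ := h2.deriv
  rw [h3, testFun, dsym_neg]
  simp only [Complex.reCLM_apply]
  congr 1
  ring

theorem mean_mul_testFun {g : UnitAddCircle → ℝ} (hg : Integrable g (AddCircle.haarAddCircle (T := 1)))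
    (c : ℂ) (k : ℤ) : mean (fun x => g x * testFun c k x) = (c * coeff g k).re := by
  unfold mean coeff fourierCoeff
  rw [← integral_const_mul, ← RCLike.re_eq_complex_re]
  have hi : Integrable (fun x => c * (fourier (-k) x • (g x : ℂ))) (AddCircle.haarAddCircle (T := 1)) :=
    (Integrable.fourier_smul (Integrable.ofReal hg) _).const_mul c
  rw [← integral_re hi]
  refine integral_congr_ae (Filter.Eventually.of_forall fun x => ?_)
  simp only [testFun, smul_eq_mul, RCLike.re_eq_complex_re]
  rw [← mul_assoc, Complex.re_mul_ofReal, mul_comm]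

theorem coeff_neg_index (g : UnitAddCircle → ℝ) (k : ℤ) :
    coeff g (-k) = (starRingEnd ℂ) (coeff g k) := by
  unfold coeff fourierCoeff
  rw [← integral_conj]
  refine integral_congr_ae (Filter.Eventually.of_forall fun x => ?_)
  simp only [smul_eq_mul, map_mul, Complex.conj_ofReal]
  rw [← fourier_neg]

theorem memLp_ofReal (g : Lp ℝ 2 (AddCircle.haarAddCircle (T := 1))) :
    MemLp (fun x => (g x : ℂ)) 2 (AddCircle.haarAddCircle (T := 1)) := (Lp.memLp g).ofReal

theorem coeff_mul_eq_conv (f g : Lp ℝ 2 (AddCircle.haarAddCircle (T := 1))) (k : ℤ) :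
    coeff (fun x => f x * g x) k = conv (coeff f) (coeff g) k := by
  have h := fourierCoeff_mul_eq_conv (memLp_ofReal f) (memLp_ofReal g) k
  unfold coeff
  push_cast
  exact h

theorem integrable_Lp (f : Lp ℝ 2 (AddCircle.haarAddCircle (T := 1))) :
    Integrable f (AddCircle.haarAddCircle (T := 1)) :=
  (Lp.memLp f).integrable (by norm_num)

theorem integrable_Lp_mul (f g : Lp ℝ 2 (AddCircle.haarAddCircle (T := 1))) :
    Integrable (fun x => f x * g x) (AddCircle.haarAddCircle (T := 1)) :=
  (Lp.memLp f).integrable_mul (Lp.memLp g)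

/-- Real test functions see only real parts. Letting the phase `c` vary, in particular `c = conj w`,
recovers the complex identity for a mode. -/
theorem eq_zero_of_forall_re {w : ℂ} (h : ∀ c : ℂ, (c * w).re = 0) : w = 0 := by
  have h1 := h (starRingEnd ℂ w)
  rw [← Complex.normSq_eq_conj_mul_self, Complex.ofReal_re] at h1
  exact Complex.normSq_eq_zero.1 h1

theorem one_add_pos {b : ℝ} (hb : 0 < b) (k : ℤ) : 0 < 1 + b * (2 * Real.pi * k) ^ 2 := by positivity

theorem dsym_sq (k : ℤ) : dsym k ^ 2 = -(((2 * Real.pi * k) ^ 2 : ℝ) : ℂ) := by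
  simp only [dsym, mul_pow, Complex.I_sq]
  push_cast
  ring

theorem IsSolution.coeff_eq {κ₁ κ₂ lam a b T μ : ℝ} (hb : 0 < b) {ζ u : ℝ → PerSobolev μ}
    (h : IsSolution κ₁ κ₂ lam a b 0 0 T ζ u) {t : ℝ} (ht : t ∈ Icc (0 : ℝ) T) (k : ℤ) :
    coeff (derivWithin ζ (Icc 0 T) t : PerSobolev μ) k = fieldZ κ₁ lam a b (coeff (ζ t)) (coeff (u t)) k ∧
    coeff (derivWithin u (Icc 0 T) t : PerSobolev μ) k = fieldU κ₂ lam (coeff (ζ t)) (coeff (u t)) k := by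
  have hi := fun g : PerSobolev μ => integrable_Lp g.toL2
  have hzu := integrable_Lp_mul (ζ t).toL2 (u t).toL2
  have huu := integrable_Lp_mul (u t).toL2 (u t).toL2
  have czu := coeff_mul_eq_conv (ζ t).toL2 (u t).toL2 k
  have cuu := coeff_mul_eq_conv (u t).toL2 (u t).toL2 k
  have H := fun c => h t ht (testFun c k) (contDiff_testFun c k)
  simp only [dx_testFun, pow_two] at H
  simp only [mean_mul_testFun (hi _), mean_mul_testFun hzu, mean_mul_testFun huu, czu, cuu] at H
  set Z' := coeff (derivWithin ζ (Icc 0 T) t : PerSobolev μ) k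
  set U' := coeff (derivWithin u (Icc 0 T) t : PerSobolev μ) k
  constructor
  · have e : Z' + κ₁ * (dsym k * coeff (u t) k) + lam * (dsym k * conv (coeff (ζ t)) (coeff (u t)) k)
        + a * (dsym k ^ 2 * (dsym k * coeff (u t) k)) - b * (dsym k ^ 2 * Z') = 0 := by
      apply eq_zero_of_forall_re
      intro c
      rw [← (H c).1]
      simp only [← Complex.re_ofReal_mul, ← Complex.sub_re]
      congr 1
      ring
    rw [dsym_sq] at e
    have hm : (((1 + b * (2 * Real.pi * k) ^ 2 : ℝ)) : ℂ) ≠ 0 := by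
      exact_mod_cast (one_add_pos hb k).ne'
    have hbc : (b : ℂ) ≠ 0 := by exact_mod_cast hb.ne'
    unfold fieldZ msym
    -- `D` is the symbol of `I - b ∂_x²`, and `dsym k ^ 2 = -(D - 1) / b`. Division by `D` splits
    -- the third-order term into the first-order part `(a/b) u_x` and the smoothed part `-(a/b) T_b
    -- u_x`.
    set D := (((1 + b * (2 * Real.pi * k) ^ 2 : ℝ)) : ℂ) with hD
    have hq : (((2 * Real.pi * k) ^ 2 : ℝ) : ℂ) = (D - 1) / b := by
      rw [hD]; push_cast; field_simp; ring
    rw [hq] at e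
    push_cast
    field_simp
    field_simp at e
    linear_combination e
  · have e : U' + κ₂ * (dsym k * coeff (ζ t) k)
        + lam * (1 / 2 * (dsym k * conv (coeff (u t)) (coeff (u t)) k)) = 0 := by
      apply eq_zero_of_forall_re
      intro c
      have := (H c).2
      rw [zero_mul, zero_mul, sub_zero, sub_zero] at this
      rw [← this]
      simp only [← Complex.re_ofReal_mul, ← Complex.sub_re]
      congr 1
      push_cast
      ring
    unfold fieldU
    linear_combination e

theorem summable_weight {μ : ℝ} (g : PerSobolev μ) :
    Summable fun k : ℤ => (1 + (k : ℝ) ^ 2) ^ μ * ‖coeff g k‖ ^ 2 := g.2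

theorem sum_weight_le {μ : ℝ} (g : PerSobolev μ) (F : Finset ℤ) :
    ∑ k ∈ F, (1 + (k : ℝ) ^ 2) ^ μ * ‖coeff g k‖ ^ 2 ≤ ‖g‖ ^ 2 := by
  have h0 : ∀ k : ℤ, 0 ≤ (1 + (k : ℝ) ^ 2) ^ μ * ‖coeff g k‖ ^ 2 := fun k => by positivity
  rw [PerSobolev.norm_eq, Real.sq_sqrt (tsum_nonneg h0)]
  exact (summable_weight g).sum_le_tsum F fun k _ => h0 k

theorem norm_coeff_le {μ : ℝ} (hμ : 0 ≤ μ) (g : PerSobolev μ) (k : ℤ) : ‖coeff g k‖ ≤ ‖g‖ := by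
  have h := sum_weight_le g {k}
  rw [Finset.sum_singleton] at h
  refine le_of_sq_le_sq ?_ (norm_nonneg _)
  refine le_trans ?_ h
  refine le_mul_of_one_le_left (by positivity) (Real.one_le_rpow ?_ hμ)
  nlinarith [sq_nonneg (k : ℝ)]

/-- The `k`-th Fourier coefficient as a continuous functional on `H^μ`. -/
noncomputable def coeffCLM {μ : ℝ} (hμ : 0 ≤ μ) (k : ℤ) : PerSobolev μ →L[ℝ] ℂ :=
  LinearMap.mkContinuous
    { toFun := fun g => coeff g k
      map_add' := fun f g => coeff_add f.toL2 g.toL2 k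
      map_smul' := fun c g => by
        rw [RingHom.id_apply, Complex.real_smul]
        exact coeff_smul c g.toL2 k } 1
    fun g => by rw [one_mul]; exact norm_coeff_le hμ g k

/-- Since `|ĝ(k)| ≤ ‖g‖_μ`, taking a coefficient is continuous and commutes with the time derivative
in `H^μ`. -/
theorem hasDerivWithinAt_coeff {μ T : ℝ} (hμ : 0 ≤ μ) {ζ : ℝ → PerSobolev μ}
    (hζ : ContDiffOn ℝ 1 ζ (Icc 0 T)) {t : ℝ} (ht : t ∈ Icc (0 : ℝ) T) (k : ℤ) :
    HasDerivWithinAt (fun s => coeff (ζ s) k) (coeff (derivWithin ζ (Icc 0 T) t : PerSobolev μ) k) (Icc 0 T) t :=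
  (coeffCLM hμ k).hasFDerivAt.comp_hasDerivWithinAt t
    ((hζ.differentiableOn (by norm_num)) t ht).hasDerivWithinAt

/-! ### The semidiscrete problem in Fourier variables -/

/-- The system of ordinary differential equations for the Fourier coefficients of the semidiscrete
solution. -/
structure IsModeSolution (κ₁ κ₂ lam a b T : ℝ) (z₀ u₀ : ℤ → ℂ) (N : ℕ) (z u : ℝ → ℤ → ℂ) :
    Prop where
  supp : ∀ t ∈ Icc (0 : ℝ) T, ∀ k ∉ Finset.Icc (-(N : ℤ)) N, z t k = 0 ∧ u t k = 0
  symm : ∀ t ∈ Icc (0 : ℝ) T, ∀ k,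
    z t (-k) = (starRingEnd ℂ) (z t k) ∧ u t (-k) = (starRingEnd ℂ) (u t k)
  deriv_z : ∀ t ∈ Icc (0 : ℝ) T, ∀ k ∈ Finset.Icc (-(N : ℤ)) N,
    HasDerivWithinAt (fun s => z s k) (fieldZ κ₁ lam a b (z t) (u t) k) (Icc 0 T) t
  deriv_u : ∀ t ∈ Icc (0 : ℝ) T, ∀ k ∈ Finset.Icc (-(N : ℤ)) N,
    HasDerivWithinAt (fun s => u s k) (fieldU κ₂ lam (z t) (u t) k) (Icc 0 T) t
  init : ∀ k ∈ Finset.Icc (-(N : ℤ)) N, z 0 k = z₀ k ∧ u 0 k = u₀ k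

theorem fourier_mem_S {N : ℕ} {k : ℤ} (hk : k ∈ Finset.Icc (-(N : ℤ)) N) :
    (fourier k : C(UnitAddCircle, ℂ)) ∈ S N :=
  Submodule.subset_span ⟨k, by simpa using hk, rfl⟩

theorem fourierCoeff_mul_continuousMap (f g : C(UnitAddCircle, ℂ)) (k : ℤ) :
    fourierCoeff (f * g : C(UnitAddCircle, ℂ)) k = conv (fourierCoeff f) (fourierCoeff g) k :=
  fourierCoeff_mul_eq_conv (memLp_continuousMap f) (memLp_continuousMap g) k

theorem fourierCoeff_tp_mul_of_mem {N : ℕ} {f : C(UnitAddCircle, ℂ)} (hf : f ∈ S N) {m : ℤ → ℂ} (k : ℤ) :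
    fourierCoeff (tp N (fun k => m k * fourierCoeff f k)) k = m k * fourierCoeff f k := by
  rw [fourierCoeff_tp]
  split_ifs with hk
  · rfl
  · rw [fourierCoeff_eq_zero_of_mem hf hk, mul_zero]

/-- One direction tests with `e^{2πikx}`, the other expands `φ` by Parseval. The product has modes
up to `2N`, but only those with `|k| ≤ N` are tested, so the full convolution appears on the right.
-/
theorem ip_eqZ_iff (κ₁ lam a b : ℝ) {N : ℕ} (g : C(UnitAddCircle, ℂ)) {z u : C(UnitAddCircle, ℂ)}
    (hz : z ∈ S N) (hu : u ∈ S N) :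
    (∀ φ ∈ S N, ip g φ - (a / b : ℝ) * ip (dx u) φ + (κ₁ + a / b : ℝ) * ip (Tinv b (dx u)) φ
      + lam * ip (Tinv b (dx (fun x => z x * u x))) φ = 0) ↔
    ∀ k ∈ Finset.Icc (-(N : ℤ)) N,
      fourierCoeff g k = fieldZ κ₁ lam a b (fourierCoeff z) (fourierCoeff u) k := by
  have h1 : (fun x => z x * u x) = ⇑(z * u : C(UnitAddCircle, ℂ)) := rfl
  have hzu := mul_mem_S hz hu
  simp only [h1, dx_of_mem hu, dx_of_mem hzu, Tinv_tp, ← mul_assoc]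
  have c1 := fun k => fourierCoeff_tp_mul_of_mem hu (m := dsym) k
  have c2 := fun k => fourierCoeff_tp_mul_of_mem hu (m := fun k => msym b k * dsym k) k
  have c3 := fun k => fourierCoeff_tp_mul_of_mem hzu (m := fun k => msym b k * dsym k) k
  simp only [fourierCoeff_mul_continuousMap] at c3 ⊢
  constructor
  · intro H k hk
    have := H _ (fourier_mem_S hk)
    simp only [ip_fourier, c1, c2, c3] at this
    unfold fieldZ
    linear_combination this
  · intro H φ hφ
    simp only [ip_eq_sum _ hφ, c1, c2, c3, Finset.mul_sum]
    rw [← Finset.sum_sub_distrib, ← Finset.sum_add_distrib, ← Finset.sum_add_distrib]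
    refine Finset.sum_eq_zero fun k hk => ?_
    rw [H k hk]
    unfold fieldZ
    ring

theorem ip_eqU_iff (κ₂ lam : ℝ) {N : ℕ} (g : C(UnitAddCircle, ℂ)) {z u : C(UnitAddCircle, ℂ)}
    (hz : z ∈ S N) (hu : u ∈ S N) :
    (∀ χ ∈ S N, ip g χ + κ₂ * ip (dx z) χ + lam * ip (fun x => u x * dx u x) χ = 0) ↔
    ∀ k ∈ Finset.Icc (-(N : ℤ)) N,
      fourierCoeff g k = fieldU κ₂ lam (fourierCoeff z) (fourierCoeff u) k := by
  have huu := mul_mem_S hu hu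
  simp only [mul_dx_self hu, dx_of_mem hz, ← mul_assoc]
  have c1 := fun k => fourierCoeff_tp_mul_of_mem hz (m := dsym) k
  have c3 := fun k => fourierCoeff_tp_mul_of_mem huu (m := fun k => 1 / 2 * dsym k) k
  simp only [fourierCoeff_mul_continuousMap] at c3 ⊢
  constructor
  · intro H k hk
    have := H _ (fourier_mem_S hk)
    simp only [ip_fourier, c1, c3] at this
    unfold fieldU
    linear_combination this
  · intro H φ hφ
    simp only [ip_eq_sum _ hφ, c1, c3, Finset.mul_sum]
    rw [← Finset.sum_add_distrib, ← Finset.sum_add_distrib]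
    refine Finset.sum_eq_zero fun k hk => ?_
    rw [H k hk]
    unfold fieldU
    ring

/-- The `k`-th Fourier coefficient as a continuous functional on continuous functions. -/
noncomputable def fourierCoeffCLM (k : ℤ) : C(UnitAddCircle, ℂ) →L[ℝ] ℂ :=
  LinearMap.mkContinuous
    { toFun := fun f => fourierCoeff f k
      map_add' := fun f g => by
        have := fourierCoeff.add (integrable_continuousMap f) (integrable_continuousMap g)
        exact congrFun this k
      map_smul' := fun c f => by
        have := fourierCoeff.const_smul (T := 1) (⇑f) (c : ℂ) k
        rw [RingHom.id_apply, Complex.real_smul, ← smul_eq_mul, ← this]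
        congr 1 } 1
    fun f => by
      rw [one_mul]
      refine (norm_integral_le_of_norm_le_const (C := ‖f‖)
        (Filter.Eventually.of_forall fun x => ?_)).trans (by simp)
      rw [norm_smul, fourier_apply, Circle.norm_coe, one_mul]
      exact f.norm_coe_le_norm x

theorem fourierCoeff_neg_index_of_real {f : C(UnitAddCircle, ℂ)} (hf : ∀ x, (f x).im = 0) (k : ℤ) :
    fourierCoeff f (-k) = (starRingEnd ℂ) (fourierCoeff f k) := by
  have h : (f : UnitAddCircle → ℂ) = fun x => (((f x).re : ℝ) : ℂ) := by
    funext x; apply Complex.ext <;> simp [hf x]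
  have h2 := coeff_neg_index (fun x => (f x).re) k
  unfold coeff at h2
  rwa [← h] at h2

theorem coeff_proj {N : ℕ} (v : UnitAddCircle → ℝ) {k : ℤ} (hk : k ∈ Finset.Icc (-(N : ℤ)) N) :
    fourierCoeff (proj N v) k = coeff v k := by
  have := fourierCoeff_tp N (coeff v) k
  rw [if_pos hk] at this
  exact this

theorem IsSemidiscreteSolution.isModeSolution {κ₁ κ₂ lam a b T : ℝ}
    {ζ₀ u₀ : UnitAddCircle → ℝ} {N : ℕ} {ζN uN : ℝ → C(UnitAddCircle, ℂ)}
    (h : IsSemidiscreteSolution κ₁ κ₂ lam a b T ζ₀ u₀ N ζN uN) :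
    IsModeSolution κ₁ κ₂ lam a b T (coeff ζ₀) (coeff u₀) N (fun t => fourierCoeff (ζN t))
      (fun t => fourierCoeff (uN t)) where
  supp t ht k hk := ⟨fourierCoeff_eq_zero_of_mem (h.mem_S t ht).1 hk,
    fourierCoeff_eq_zero_of_mem (h.mem_S t ht).2 hk⟩
  symm t ht k := ⟨fourierCoeff_neg_index_of_real (fun x => (h.real_valued t ht x).1) k,
    fourierCoeff_neg_index_of_real (fun x => (h.real_valued t ht x).2) k⟩
  deriv_z t ht k hk := by
    rw [← (ip_eqZ_iff κ₁ lam a b (derivWithin ζN (Icc 0 T) t) (h.mem_S t ht).1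
      (h.mem_S t ht).2).1 (h.eq_ζ t ht) k hk]
    exact (fourierCoeffCLM k).hasFDerivAt.comp_hasDerivWithinAt t
      (h.differentiable.1 t ht).hasDerivWithinAt
  deriv_u t ht k hk := by
    rw [← (ip_eqU_iff κ₂ lam (derivWithin uN (Icc 0 T) t) (h.mem_S t ht).1
      (h.mem_S t ht).2).1 (h.eq_u t ht) k hk]
    exact (fourierCoeffCLM k).hasFDerivAt.comp_hasDerivWithinAt t
      (h.differentiable.2 t ht).hasDerivWithinAt
  init k hk := by
    rw [h.initial.1, h.initial.2]
    exact ⟨coeff_proj _ hk, coeff_proj _ hk⟩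

theorem tp_real {N : ℕ} {c : ℤ → ℂ} (hc : ∀ k, c (-k) = (starRingEnd ℂ) (c k)) (x : UnitAddCircle) :
    (tp N c x).im = 0 := by
  rw [← Complex.conj_eq_iff_im, tp_apply, map_sum]
  refine Finset.sum_nbij' (fun k => -k) (fun k => -k) ?_ ?_ ?_ ?_ ?_
  · intro k hk; simp only [Finset.mem_Icc] at *; omega
  · intro k hk; simp only [Finset.mem_Icc] at *; omega
  · intro k _; simp
  · intro k _; simp
  · intro k _; rw [hc, map_mul, fourier_neg]

theorem hasDerivWithinAt_tp {N : ℕ} {c : ℝ → ℤ → ℂ} {c' : ℤ → ℂ} {s : Set ℝ} {t : ℝ}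
    (h : ∀ k ∈ Finset.Icc (-(N : ℤ)) N, HasDerivWithinAt (fun r => c r k) (c' k) s t) :
    HasDerivWithinAt (fun r => tp N (c r)) (tp N c') s t :=
  HasDerivWithinAt.fun_sum fun k hk => (h k hk).smul_const (fourier k : C(UnitAddCircle, ℂ))

theorem IsModeSolution.isSemidiscreteSolution {κ₁ κ₂ lam a b T : ℝ} (hT : 0 < T)
    {ζ₀ u₀ : UnitAddCircle → ℝ} {N : ℕ} {z u : ℝ → ℤ → ℂ}
    (h : IsModeSolution κ₁ κ₂ lam a b T (coeff ζ₀) (coeff u₀) N z u) :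
    IsSemidiscreteSolution κ₁ κ₂ lam a b T ζ₀ u₀ N (fun t => tp N (z t)) (fun t => tp N (u t)) := by
  have hz : ∀ t ∈ Icc (0 : ℝ) T, fourierCoeff (tp N (z t)) = z t := by
    intro t ht; funext k
    rw [fourierCoeff_tp]
    split_ifs with hk
    · rfl
    · exact (h.supp t ht k hk).1.symm
  have hu : ∀ t ∈ Icc (0 : ℝ) T, fourierCoeff (tp N (u t)) = u t := by
    intro t ht; funext k
    rw [fourierCoeff_tp]
    split_ifs with hk
    · rfl
    · exact (h.supp t ht k hk).2.symm
  have hdz := fun t ht => hasDerivWithinAt_tp (h.deriv_z t ht)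
  have hdu := fun t ht => hasDerivWithinAt_tp (h.deriv_u t ht)
  have huniq : ∀ t ∈ Icc (0 : ℝ) T, UniqueDiffWithinAt ℝ (Icc 0 T) t := uniqueDiffOn_Icc hT
  refine ⟨fun t _ => ⟨tp_mem _ _, tp_mem _ _⟩,
    fun t ht x => ⟨tp_real (fun k => (h.symm t ht k).1) x, tp_real (fun k => (h.symm t ht k).2) x⟩,
    ⟨fun t ht => (hdz t ht).differentiableWithinAt, fun t ht => (hdu t ht).differentiableWithinAt⟩,
    fun t ht => ?_, fun t ht => ?_, ?_⟩
  · rw [ip_eqZ_iff κ₁ lam a b _ (tp_mem _ _) (tp_mem _ _), (hdz t ht).derivWithin (huniq t ht),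
      hz t ht, hu t ht]
    intro k hk
    rw [fourierCoeff_tp, if_pos hk]
  · rw [ip_eqU_iff κ₂ lam _ (tp_mem _ _) (tp_mem _ _), (hdu t ht).derivWithin (huniq t ht),
      hz t ht, hu t ht]
    intro k hk
    rw [fourierCoeff_tp, if_pos hk]
  · exact ⟨tp_congr fun k hk => (h.init k hk).1, tp_congr fun k hk => (h.init k hk).2⟩

theorem l2norm_eq {f : UnitAddCircle → ℂ} (hf : MemLp f 2 (AddCircle.haarAddCircle (T := 1))) :
    (Summable fun k => ‖fourierCoeff f k‖ ^ 2) ∧ l2norm f = Real.sqrt (∑' k, ‖fourierCoeff f k‖ ^ 2) := by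
  have h := hasSum_sq_fourierCoeff (hf.toLp f)
  rw [fourierCoeff_congr_ae hf.coeFn_toLp] at h
  refine ⟨h.summable, ?_⟩
  rw [h.tsum_eq, l2norm]
  congr 1
  refine integral_congr_ae ?_
  filter_upwards [hf.coeFn_toLp] with x hx
  rw [hx]

/-! ### Bounds for sequences -/

/-- The `ℓ²` norm of `a` is at most `A`. -/
def L2Bd (a : ℤ → ℂ) (A : ℝ) : Prop := 0 ≤ A ∧ ∀ F : Finset ℤ, ∑ k ∈ F, ‖a k‖ ^ 2 ≤ A ^ 2

/-- The `ℓ¹` norm of `a` is at most `A`. -/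
def L1Bd (a : ℤ → ℂ) (A : ℝ) : Prop := 0 ≤ A ∧ ∀ F : Finset ℤ, ∑ k ∈ F, ‖a k‖ ≤ A

theorem L2Bd.mono {a b : ℤ → ℂ} {A : ℝ} (h : L2Bd b A) (hab : ∀ k, ‖a k‖ ≤ ‖b k‖) : L2Bd a A :=
  ⟨h.1, fun F => (Finset.sum_le_sum fun k _ => pow_le_pow_left₀ (norm_nonneg _) (hab k) 2).trans (h.2 F)⟩

theorem L1Bd.mono {a b : ℤ → ℂ} {A : ℝ} (h : L1Bd b A) (hab : ∀ k, ‖a k‖ ≤ ‖b k‖) : L1Bd a A :=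
  ⟨h.1, fun F => (Finset.sum_le_sum fun k _ => hab k).trans (h.2 F)⟩

theorem L2Bd.mono_right {a : ℤ → ℂ} {A B : ℝ} (h : L2Bd a A) (hAB : A ≤ B) : L2Bd a B :=
  ⟨h.1.trans hAB, fun F => (h.2 F).trans (pow_le_pow_left₀ h.1 hAB 2)⟩

theorem L2Bd.norm_le {a : ℤ → ℂ} {A : ℝ} (h : L2Bd a A) (k : ℤ) : ‖a k‖ ≤ A := by
  have := h.2 {k}
  rw [Finset.sum_singleton] at this
  exact le_of_sq_le_sq this h.1

theorem L2Bd.sub_index {a : ℤ → ℂ} {A : ℝ} (h : L2Bd a A) (k : ℤ) : L2Bd (fun j => a (k - j)) A :=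
  ⟨h.1, fun F => by
    have := h.2 (F.map (Equiv.subLeft k).toEmbedding)
    rwa [Finset.sum_map] at this⟩

theorem L2Bd.sub_index' {a : ℤ → ℂ} {A : ℝ} (h : L2Bd a A) (k : ℤ) : L2Bd (fun j => a (j - k)) A :=
  ⟨h.1, fun F => by
    have := h.2 (F.map (Equiv.subRight k).toEmbedding)
    rwa [Finset.sum_map] at this⟩

theorem L2Bd.sum_mul_le {a b : ℤ → ℂ} {A B : ℝ} (ha : L2Bd a A) (hb : L2Bd b B) (F : Finset ℤ) :
    ∑ k ∈ F, ‖a k‖ * ‖b k‖ ≤ A * B := by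
  have h := Finset.sum_mul_sq_le_sq_mul_sq F (fun k => ‖a k‖) (fun k => ‖b k‖)
  refine le_of_sq_le_sq (h.trans ?_) (mul_nonneg ha.1 hb.1)
  rw [mul_pow]
  exact mul_le_mul (ha.2 F) (hb.2 F) (Finset.sum_nonneg fun _ _ => by positivity) (by positivity)

theorem L1Bd.summable {a : ℤ → ℂ} {A : ℝ} (h : L1Bd a A) : Summable fun k => ‖a k‖ :=
  summable_of_sum_le (fun _ => norm_nonneg _) h.2

theorem L2Bd.mul {a b : ℤ → ℂ} {A B : ℝ} (ha : L2Bd a A) (hb : L2Bd b B) :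
    L1Bd (fun k => a k * b k) (A * B) :=
  ⟨mul_nonneg ha.1 hb.1, fun F => by simpa only [norm_mul] using ha.sum_mul_le hb F⟩

theorem L2Bd.summable_conv {a b : ℤ → ℂ} {A B : ℝ} (ha : L2Bd a A) (hb : L2Bd b B) (k : ℤ) :
    Summable fun j => a j * b (k - j) :=
  (ha.mul (hb.sub_index k)).summable.of_norm

theorem L2Bd.norm_conv_le {a b : ℤ → ℂ} {A B : ℝ} (ha : L2Bd a A) (hb : L2Bd b B) (k : ℤ) :
    ‖conv a b k‖ ≤ A * B := by
  have h := ha.mul (hb.sub_index k)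
  refine (norm_tsum_le_tsum_norm h.summable).trans ?_
  exact h.summable.tsum_le_of_sum_le h.2

theorem L2Bd.add {a b : ℤ → ℂ} {A B : ℝ} (ha : L2Bd a A) (hb : L2Bd b B) :
    L2Bd (a + b) (A + B) := by
  refine ⟨add_nonneg ha.1 hb.1, fun F => ?_⟩
  have h := ha.sum_mul_le hb F
  calc ∑ k ∈ F, ‖(a + b) k‖ ^ 2 ≤ ∑ k ∈ F, (‖a k‖ ^ 2 + ‖b k‖ ^ 2 + 2 * (‖a k‖ * ‖b k‖)) := by
        refine Finset.sum_le_sum fun k _ => ?_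
        have := norm_add_le (a k) (b k)
        calc ‖(a + b) k‖ ^ 2 ≤ (‖a k‖ + ‖b k‖) ^ 2 := pow_le_pow_left₀ (norm_nonneg _) this 2
          _ = _ := by ring
    _ ≤ _ := by
        rw [Finset.sum_add_distrib, Finset.sum_add_distrib, ← Finset.mul_sum]
        nlinarith [ha.2 F, hb.2 F]

theorem L2Bd.neg {a : ℤ → ℂ} {A : ℝ} (ha : L2Bd a A) : L2Bd (-a) A :=
  ha.mono fun k => by simp

theorem exists_L2Bd {a : ℤ → ℂ} (h : Summable fun k => ‖a k‖ ^ 2) : ∃ A, L2Bd a A :=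
  ⟨Real.sqrt (∑' k, ‖a k‖ ^ 2), Real.sqrt_nonneg _, fun F => by
    rw [Real.sq_sqrt (tsum_nonneg fun _ => by positivity)]
    exact h.sum_le_tsum F fun k _ => by positivity⟩

theorem conv_comm (a b : ℤ → ℂ) : conv a b = conv b a := by
  funext k
  unfold conv
  rw [← (Equiv.subLeft k).tsum_eq]
  refine tsum_congr fun j => ?_
  simp [mul_comm]

theorem conv_add_right {a b c : ℤ → ℂ} {A B C : ℝ} (ha : L2Bd a A) (hb : L2Bd b B) (hc : L2Bd c C)
    (k : ℤ) : conv a (b + c) k = conv a b k + conv a c k := by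
  unfold conv
  rw [← (ha.summable_conv hb k).tsum_add (ha.summable_conv hc k)]
  exact tsum_congr fun j => by simp [mul_add]

theorem conv_add_left {a b c : ℤ → ℂ} {A B C : ℝ} (ha : L2Bd a A) (hb : L2Bd b B) (hc : L2Bd c C)
    (k : ℤ) : conv (a + b) c k = conv a c k + conv b c k := by
  rw [conv_comm, conv_add_right hc ha hb, conv_comm c a, conv_comm c b]

theorem conv_eq_sum {F : Finset ℤ} {a : ℤ → ℂ} (ha : ∀ k ∉ F, a k = 0) (b : ℤ → ℂ) (k : ℤ) :
    conv a b k = ∑ j ∈ F, a j * b (k - j) :=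
  tsum_eq_sum fun j hj => by rw [ha j hj, zero_mul]

/-- Young's inequality `‖g * a‖₂ ≤ ‖g‖₁ ‖a‖₂`, tested with `b`. -/
theorem sum_tsum_le {a b g : ℤ → ℂ} {A B G : ℝ} (ha : L2Bd a A) (hb : L2Bd b B) (hg : L1Bd g G)
    (F : Finset ℤ) : ∑ k ∈ F, (∑' j, ‖a (k - j)‖ * ‖g j‖) * ‖b k‖ ≤ A * B * G := by
  have hs : ∀ k, Summable fun j => ‖a (k - j)‖ * ‖g j‖ * ‖b k‖ := fun k => by
    refine Summable.mul_right _ (Summable.of_nonneg_of_le (fun _ => by positivity) (fun j => ?_)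
      (hg.summable.mul_left A))
    exact mul_le_mul_of_nonneg_right (ha.norm_le _) (norm_nonneg _)
  simp only [← tsum_mul_right]
  rw [← Summable.tsum_finsetSum fun k _ => hs k]
  have hle : ∀ j, ∑ k ∈ F, ‖a (k - j)‖ * ‖g j‖ * ‖b k‖ ≤ A * B * ‖g j‖ := fun j => by
    have := (ha.sub_index' j).sum_mul_le hb F
    calc _ = (∑ k ∈ F, ‖a (k - j)‖ * ‖b k‖) * ‖g j‖ := by
          rw [Finset.sum_mul]; exact Finset.sum_congr rfl fun k _ => by ring
      _ ≤ _ := mul_le_mul_of_nonneg_right this (norm_nonneg _)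
  refine (Summable.tsum_le_tsum hle (summable_sum fun k _ => hs k) (hg.summable.mul_left _)).trans ?_
  rw [tsum_mul_left]
  exact mul_le_mul_of_nonneg_left (hg.summable.tsum_le_of_sum_le hg.2) (mul_nonneg ha.1 hb.1)

/-! ### Sobolev weights, truncation and the smoothing symbol -/

/-- The weight `2π(1+k²)^{1/2}`. -/
noncomputable def wt (k : ℤ) : ℝ := 2 * Real.pi * Real.sqrt (1 + (k : ℝ) ^ 2)

theorem norm_dsym (k : ℤ) : ‖dsym k‖ = 2 * Real.pi * |(k : ℝ)| := by
  simp [dsym, abs_of_pos Real.pi_pos]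

theorem one_le_wt (k : ℤ) : 1 ≤ wt k := by
  have h1 : 1 ≤ Real.sqrt (1 + (k : ℝ) ^ 2) := Real.one_le_sqrt.2 (by nlinarith [sq_nonneg (k : ℝ)])
  unfold wt
  nlinarith [Real.pi_gt_three]

theorem wt_sq (k : ℤ) : wt k ^ 2 = (2 * Real.pi) ^ 2 * (1 + (k : ℝ) ^ 2) := by
  rw [wt, mul_pow, Real.sq_sqrt (by positivity)]

theorem norm_dsym_le (k : ℤ) : ‖dsym k‖ ≤ wt k := by
  rw [norm_dsym, wt]
  refine mul_le_mul_of_nonneg_left ?_ (by positivity)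
  exact Real.abs_le_sqrt (by linarith)

/-- This distributes one derivative over a product. It rests on `(1 + l²)(1 + j²) - (l + j)² = (1 -
l j)²` with `l = k - j`, and on `2π ≥ 1`. -/
theorem norm_dsym_le_mul (k j : ℤ) : ‖dsym k‖ ≤ wt (k - j) * wt j := by
  have h0 : 0 ≤ wt (k - j) * wt j :=
    mul_nonneg (zero_le_one.trans (one_le_wt _)) (zero_le_one.trans (one_le_wt _))
  refine le_of_sq_le_sq ?_ h0
  rw [mul_pow, wt_sq, wt_sq, norm_dsym, mul_pow, sq_abs]
  push_cast
  set l : ℝ := (k : ℝ) - j with hl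
  have hk : (k : ℝ) = l + j := by rw [hl]; ring
  have hp : 1 ≤ (2 * Real.pi) ^ 2 := by nlinarith [Real.pi_gt_three]
  have h1 : (l + j) ^ 2 ≤ (1 + l ^ 2) * (1 + (j : ℝ) ^ 2) := by nlinarith [sq_nonneg (1 - l * j)]
  rw [hk]
  have h2 : (1 + l ^ 2) * (1 + (j : ℝ) ^ 2) ≤ (2 * Real.pi) ^ 2 * ((1 + l ^ 2) * (1 + (j : ℝ) ^ 2)) :=
    le_mul_of_one_le_left (by positivity) hp
  calc (2 * Real.pi) ^ 2 * (l + j) ^ 2 ≤ (2 * Real.pi) ^ 2 * ((2 * Real.pi) ^ 2 * ((1 + l ^ 2) * (1 + (j : ℝ) ^ 2))) :=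
        mul_le_mul_of_nonneg_left (h1.trans h2) (by positivity)
    _ = _ := by ring

theorem summable_weight_rpow {s : ℝ} (hs : 1 / 2 < s) :
    Summable fun k : ℤ => (1 + (k : ℝ) ^ 2) ^ (-s) := by
  have h := Real.summable_abs_int_rpow (b := 2 * s) (by linarith)
  refine Summable.of_norm_bounded_eventually h ?_
  -- The mode `k = 0` is excepted because `0 ^ (-(2 * s))` is `0` as a real power.
  have hf : {k : ℤ | ¬ ‖(1 + (k : ℝ) ^ 2) ^ (-s)‖ ≤ |(k : ℝ)| ^ (-(2 * s))} ⊆ {0} := by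
    intro k hk
    by_contra h0
    apply hk
    have hk0 : 0 < |(k : ℝ)| := abs_pos.2 (by exact_mod_cast h0)
    rw [Real.norm_of_nonneg (by positivity), ← mul_neg, Real.rpow_mul hk0.le]
    refine Real.rpow_le_rpow_of_nonpos (by positivity) ?_ (by linarith)
    rw [Real.rpow_two, sq_abs]
    linarith
  exact (Set.finite_singleton (0 : ℤ)).subset hf

/-- The `H^μ` norm of the function with coefficients `a` is at most `M`. -/
def SobBd (μ : ℝ) (a : ℤ → ℂ) (M : ℝ) : Prop :=
  0 ≤ M ∧ ∀ F : Finset ℤ, ∑ k ∈ F, (1 + (k : ℝ) ^ 2) ^ μ * ‖a k‖ ^ 2 ≤ M ^ 2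

theorem SobBd.l2 {μ M : ℝ} (hμ : 0 ≤ μ) {a : ℤ → ℂ} (h : SobBd μ a M) : L2Bd a M :=
  ⟨h.1, fun F => (Finset.sum_le_sum fun k _ => le_mul_of_one_le_left (by positivity)
    (Real.one_le_rpow (by nlinarith [sq_nonneg (k : ℝ)]) hμ)).trans (h.2 F)⟩

theorem SobBd.weighted {μ M : ℝ} {a : ℤ → ℂ} (h : SobBd μ a M) :
    L2Bd (fun k => (((1 + (k : ℝ) ^ 2) ^ (μ / 2) : ℝ) : ℂ) * a k) M := by
  refine ⟨h.1, fun F => le_trans (le_of_eq (Finset.sum_congr rfl fun k _ => ?_)) (h.2 F)⟩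
  rw [norm_mul, mul_pow, Complex.norm_real, Real.norm_eq_abs, sq_abs, ← Real.rpow_mul_natCast (by positivity)]
  norm_num

/-- Cauchy–Schwarz against `wt k (1 + k²)^{-μ/2}`, whose square is a multiple of `(1 + k²)^{-(μ -
1)}` and is summable because `μ - 1 > 1/2`. This is the step that requires `μ > 3/2`. -/
theorem exists_weight_l1 {μ : ℝ} (hμ : 3 / 2 < μ) :
    ∃ C : ℝ, 0 ≤ C ∧ ∀ (a : ℤ → ℂ) (M : ℝ), SobBd μ a M → L1Bd (fun k => wt k * a k) (C * M) := by
  have hs : Summable fun k : ℤ => ‖((wt k * (1 + (k : ℝ) ^ 2) ^ (-(μ / 2)) : ℝ) : ℂ)‖ ^ 2 := by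
    refine ((summable_weight_rpow (s := μ - 1) (by linarith)).mul_left ((2 * Real.pi) ^ 2)).congr
      fun k => ?_
    have hk : 0 < 1 + (k : ℝ) ^ 2 := by positivity
    rw [Complex.norm_real, Real.norm_eq_abs, sq_abs, mul_pow (wt k), wt_sq,
      ← Real.rpow_mul_natCast hk.le, mul_assoc]
    congr 1
    nth_rewrite 2 [← Real.rpow_one (1 + (k : ℝ) ^ 2)]
    rw [← Real.rpow_add hk]
    congr 1
    push_cast
    ring
  obtain ⟨C, hC⟩ := exists_L2Bd hs
  refine ⟨C, hC.1, fun a M ha => (hC.mul ha.weighted).mono fun k => le_of_eq ?_⟩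
  congr 1
  have hk : 0 < 1 + (k : ℝ) ^ 2 := by positivity
  have : ((1 + (k : ℝ) ^ 2) ^ (-(μ / 2)) * (1 + (k : ℝ) ^ 2) ^ (μ / 2) : ℝ) = 1 := by
    rw [← Real.rpow_add hk]; simp
  have h2 : (((1 + (k : ℝ) ^ 2) ^ (-(μ / 2)) : ℝ) : ℂ) * (((1 + (k : ℝ) ^ 2) ^ (μ / 2) : ℝ) : ℂ) = 1 := by
    exact_mod_cast this
  push_cast at h2 ⊢
  linear_combination (-(wt k * a k : ℂ)) * h2

/-- Truncation to the modes `|k| ≤ N`. -/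
noncomputable def trunc (N : ℕ) (a : ℤ → ℂ) (k : ℤ) : ℂ := if k ∈ Finset.Icc (-(N : ℤ)) N then a k else 0

theorem norm_trunc_le (N : ℕ) (a : ℤ → ℂ) (k : ℤ) : ‖trunc N a k‖ ≤ ‖a k‖ := by
  unfold trunc; split_ifs <;> simp

theorem SobBd.trunc {μ M : ℝ} {a : ℤ → ℂ} (h : SobBd μ a M) (N : ℕ) : SobBd μ (trunc N a) M :=
  ⟨h.1, fun F => (Finset.sum_le_sum fun k _ => mul_le_mul_of_nonneg_left
    (pow_le_pow_left₀ (norm_nonneg _) (norm_trunc_le N a k) 2) (by positivity)).trans (h.2 F)⟩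

/-- Beyond `N` one has `(1 + k²)^{1-μ} ≤ N^{2(1-μ)}`, the exponent being nonpositive. One derivative
is already included in the weight, which explains the rate `1 - μ`. -/
theorem SobBd.tail {μ M : ℝ} (hμ : 1 ≤ μ) {a : ℤ → ℂ} (h : SobBd μ a M) {N : ℕ} (hN : 1 ≤ N) :
    L2Bd (fun k => wt k * (a k - PeriodicBoussinesq.trunc N a k)) (2 * Real.pi * M * (N : ℝ) ^ (1 - μ)) := by
  have hN0 : (0 : ℝ) < N := by exact_mod_cast hN
  refine ⟨by have := h.1; positivity, fun F => ?_⟩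
  have hk : ∀ k ∈ F, ‖(wt k : ℂ) * (a k - PeriodicBoussinesq.trunc N a k)‖ ^ 2
      ≤ ((2 * Real.pi) ^ 2 * ((N : ℝ) ^ (1 - μ)) ^ 2) * ((1 + (k : ℝ) ^ 2) ^ μ * ‖a k‖ ^ 2) := by
    intro k _
    unfold PeriodicBoussinesq.trunc
    split_ifs with hk
    · simp; positivity
    · have hkp : 0 < 1 + (k : ℝ) ^ 2 := by positivity
      rw [sub_zero, norm_mul, mul_pow, Complex.norm_real, Real.norm_eq_abs, sq_abs, wt_sq]
      have e : (1 + (k : ℝ) ^ 2) = (1 + (k : ℝ) ^ 2) ^ (1 - μ) * (1 + (k : ℝ) ^ 2) ^ μ := by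
        rw [← Real.rpow_add hkp]; simp
      have hle : (1 + (k : ℝ) ^ 2) ^ (1 - μ) ≤ ((N : ℝ) ^ (1 - μ)) ^ 2 := by
        rw [← Real.rpow_mul_natCast hN0.le, mul_comm (1 - μ), Real.rpow_mul hN0.le]
        refine Real.rpow_le_rpow_of_nonpos (by positivity) ?_ (by linarith)
        rw [Nat.cast_ofNat, Real.rpow_two]
        have : (N : ℤ) ^ 2 ≤ k ^ 2 := by
          rw [Finset.mem_Icc] at hk
          refine sq_le_sq.2 ?_
          rw [Nat.abs_cast]
          exact le_abs.2 (by omega)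
        have h3 : (N : ℝ) ^ 2 ≤ (k : ℝ) ^ 2 := by exact_mod_cast this
        linarith
      calc _ = (2 * Real.pi) ^ 2 * ((1 + (k : ℝ) ^ 2) ^ (1 - μ) * ((1 + (k : ℝ) ^ 2) ^ μ * ‖a k‖ ^ 2)) := by
            nth_rewrite 1 [e]; ring
        _ ≤ (2 * Real.pi) ^ 2 * (((N : ℝ) ^ (1 - μ)) ^ 2 * ((1 + (k : ℝ) ^ 2) ^ μ * ‖a k‖ ^ 2)) := by
            gcongr
        _ = _ := by ring
  refine (Finset.sum_le_sum hk).trans ?_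
  rw [← Finset.mul_sum]
  calc _ ≤ ((2 * Real.pi) ^ 2 * ((N : ℝ) ^ (1 - μ)) ^ 2) * M ^ 2 :=
        mul_le_mul_of_nonneg_left (h.2 F) (by positivity)
    _ = _ := by ring

/-- The symbol of `T_b ∂_x` decays like `1/|k|`. Its square summability, stronger than boundedness,
is what allows products of errors to be measured in `ℓ^∞` only. -/
theorem exists_msym_bound {b : ℝ} (hb : 0 < b) : ∃ B, L2Bd (fun k => msym b k * dsym k) B := by
  apply exists_L2Bd
  refine Summable.of_nonneg_of_le (fun _ => by positivity) (fun k => ?_)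
    ((summable_weight_rpow (s := 1) (by norm_num)).mul_left (1 / (2 * b) + 1 / b ^ 2))
  have hp := one_add_pos hb k
  have hkp : 0 < 1 + (k : ℝ) ^ 2 := by positivity
  rw [norm_mul, mul_pow, norm_dsym, mul_pow, sq_abs, msym, norm_div, norm_one, Complex.norm_real,
    Real.norm_of_nonneg hp.le, div_pow, one_pow, Real.rpow_neg_one]
  rw [← div_eq_mul_inv, le_div_iff₀ hkp, one_div_mul_eq_div, div_mul_eq_mul_div, div_le_iff₀ (by positivity)]
  set x : ℝ := 2 * Real.pi * k with hx
  have hxk : (k : ℝ) ^ 2 ≤ x ^ 2 := by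
    rw [hx, mul_pow]
    refine le_mul_of_one_le_left (by positivity) ?_
    nlinarith [Real.pi_gt_three]
  have e : (2 * Real.pi) ^ 2 * (k : ℝ) ^ 2 = x ^ 2 := by rw [hx]; ring
  rw [e]
  calc x ^ 2 * (1 + (k : ℝ) ^ 2) ≤ x ^ 2 * (1 + x ^ 2) := by gcongr
    _ ≤ (1 / (2 * b) + 1 / b ^ 2) * (2 * (b * x ^ 2) + b ^ 2 * (x ^ 2) ^ 2) := by
        have : (1 / (2 * b) + 1 / b ^ 2) * (2 * (b * x ^ 2) + b ^ 2 * (x ^ 2) ^ 2)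
          = x ^ 2 * (1 + x ^ 2) + (2 / b * x ^ 2 + b / 2 * (x ^ 2) ^ 2) := by field_simp; ring
        rw [this]
        have : 0 ≤ 2 / b * x ^ 2 + b / 2 * (x ^ 2) ^ 2 := by positivity
        linarith
    _ ≤ _ := by
        refine mul_le_mul_of_nonneg_left ?_ (by positivity)
        nlinarith

/-! ### The energy estimate -/

/-- Used for all terms with `T_b ∂_x`: `m` is its symbol and `x` a linear or quadratic expression
known only in the sup norm. -/
theorem norm_sum_mul_conj_le {m x θ : ℤ → ℂ} {B X Θ : ℝ} (hm : L2Bd m B) (hx : ∀ k, ‖x k‖ ≤ X)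
    (hθ : L2Bd θ Θ) (F : Finset ℤ) :
    ‖∑ k ∈ F, m k * x k * (starRingEnd ℂ) (θ k)‖ ≤ X * (B * Θ) := by
  have hX : 0 ≤ X := (norm_nonneg _).trans (hx 0)
  calc _ ≤ ∑ k ∈ F, X * (‖m k‖ * ‖θ k‖) := by
        refine norm_sum_le_of_le _ fun k _ => ?_
        rw [norm_mul, norm_mul, RCLike.norm_conj]
        nlinarith [hx k, mul_nonneg (norm_nonneg (m k)) (norm_nonneg (θ k))]
    _ ≤ _ := by
        rw [← Finset.mul_sum]
        exact mul_le_mul_of_nonneg_left (hm.sum_mul_le hθ F) hX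

theorem norm_sum_conv_conj_le {a b g : ℤ → ℂ} {A B G : ℝ} (ha : L2Bd a A) (hb : L2Bd b B)
    (hg : L1Bd g G) (F : Finset ℤ) :
    ‖∑ k ∈ F, conv a g k * (starRingEnd ℂ) (b k)‖ ≤ A * B * G := by
  refine le_trans ?_ (sum_tsum_le ha hb hg F)
  refine norm_sum_le_of_le _ fun k _ => ?_
  rw [norm_mul, RCLike.norm_conj, conv_comm]
  refine mul_le_mul_of_nonneg_right ?_ (norm_nonneg _)
  have hs : Summable fun j => ‖g j * a (k - j)‖ := by
    refine Summable.of_nonneg_of_le (fun _ => norm_nonneg _) (fun j => ?_) (hg.summable.mul_left A)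
    rw [norm_mul, mul_comm]
    exact mul_le_mul_of_nonneg_right (ha.norm_le _) (norm_nonneg _)
  refine (norm_tsum_le_tsum_norm hs).trans (le_of_eq (tsum_congr fun j => ?_))
  rw [norm_mul, mul_comm]

/-- The derivative is split between the factors by `norm_dsym_le_mul`, after which Young's
inequality applies. It serves the tail terms, where `a` is the small factor. -/
theorem norm_sum_dsym_conv_conj_le {a b g : ℤ → ℂ} {A B G : ℝ} (ha : L2Bd (fun k => wt k * a k) A)
    (hb : L2Bd b B) (hg : L1Bd (fun k => wt k * g k) G) (F : Finset ℤ) :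
    ‖∑ k ∈ F, dsym k * conv a g k * (starRingEnd ℂ) (b k)‖ ≤ A * B * G := by
  refine le_trans ?_ (sum_tsum_le ha hb hg F)
  refine norm_sum_le_of_le _ fun k _ => ?_
  rw [norm_mul, RCLike.norm_conj, conv_comm, conv, ← tsum_mul_left]
  refine mul_le_mul_of_nonneg_right ?_ (norm_nonneg _)
  have hs : Summable fun j => ‖(wt (k - j) : ℂ) * a (k - j)‖ * ‖(wt j : ℂ) * g j‖ := by
    refine Summable.of_nonneg_of_le (fun _ => by positivity) (fun j => ?_) (hg.summable.mul_left A)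
    exact mul_le_mul_of_nonneg_right (ha.norm_le _) (norm_nonneg _)
  have hle : ∀ j, ‖dsym k * (g j * a (k - j))‖
      ≤ ‖(wt (k - j) : ℂ) * a (k - j)‖ * ‖(wt j : ℂ) * g j‖ := by
    intro j
    have h1 : 0 ≤ wt j := zero_le_one.trans (one_le_wt _)
    have h2 : 0 ≤ wt (k - j) := zero_le_one.trans (one_le_wt _)
    simp only [norm_mul, Complex.norm_real, Real.norm_of_nonneg h1, Real.norm_of_nonneg h2]
    calc _ ≤ (wt (k - j) * wt j) * (‖g j‖ * ‖a (k - j)‖) :=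
          mul_le_mul_of_nonneg_right (norm_dsym_le_mul k j) (by positivity)
      _ = _ := by ring
  exact tsum_of_norm_bounded hs.hasSum hle

/-! ### Cancellations by integration by parts -/

theorem conj_dsym (k : ℤ) : (starRingEnd ℂ) (dsym k) = -dsym k := by
  apply Complex.ext <;> simp [dsym]

/-- This is `2 ∫ (ξ v)_x ξ = ∫ v_x ξ²` for real `v`. Conjugating the double sum and exchanging the
indices turns the factor `dsym k` into `-dsym j`; adding the two leaves `dsym k - dsym j = dsym (k -
j)`, a derivative of `v` alone. -/
theorem two_mul_re_commutator {F : Finset ℤ} {ξ v : ℤ → ℂ} (hξ : ∀ k ∉ F, ξ k = 0)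
    (hv : ∀ k, v (-k) = (starRingEnd ℂ) (v k)) :
    2 * (∑ k ∈ F, dsym k * conv ξ v k * (starRingEnd ℂ) (ξ k)).re
      = (∑ k ∈ F, conv ξ (fun k => dsym k * v k) k * (starRingEnd ℂ) (ξ k)).re := by
  have e1 : ∑ k ∈ F, dsym k * conv ξ v k * (starRingEnd ℂ) (ξ k)
      = ∑ k ∈ F, ∑ j ∈ F, dsym k * v (k - j) * ξ j * (starRingEnd ℂ) (ξ k) := by
    refine Finset.sum_congr rfl fun k _ => ?_
    rw [conv_eq_sum hξ, Finset.mul_sum, Finset.sum_mul]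
    exact Finset.sum_congr rfl fun j _ => by ring
  have e2 : (starRingEnd ℂ) (∑ k ∈ F, dsym k * conv ξ v k * (starRingEnd ℂ) (ξ k))
      = ∑ k ∈ F, ∑ j ∈ F, -dsym j * v (k - j) * ξ j * (starRingEnd ℂ) (ξ k) := by
    rw [e1, Finset.sum_comm, map_sum]
    refine Finset.sum_congr rfl fun k _ => ?_
    rw [map_sum]
    refine Finset.sum_congr rfl fun j _ => ?_
    simp only [map_mul, Complex.conj_conj, conj_dsym]
    rw [← hv, neg_sub]
    ring
  have e3 : ∑ k ∈ F, conv ξ (fun k => dsym k * v k) k * (starRingEnd ℂ) (ξ k)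
      = ∑ k ∈ F, ∑ j ∈ F, (dsym k - dsym j) * v (k - j) * ξ j * (starRingEnd ℂ) (ξ k) := by
    refine Finset.sum_congr rfl fun k _ => ?_
    rw [conv_eq_sum hξ, Finset.sum_mul]
    refine Finset.sum_congr rfl fun j _ => ?_
    have : dsym (k - j) = dsym k - dsym j := by simp [dsym]; ring
    rw [this]
    ring
  have e4 : (∑ k ∈ F, dsym k * conv ξ v k * (starRingEnd ℂ) (ξ k))
      + (starRingEnd ℂ) (∑ k ∈ F, dsym k * conv ξ v k * (starRingEnd ℂ) (ξ k))
      = ∑ k ∈ F, conv ξ (fun k => dsym k * v k) k * (starRingEnd ℂ) (ξ k) := by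
    rw [e2, e1, e3, ← Finset.sum_add_distrib]
    refine Finset.sum_congr rfl fun k _ => ?_
    rw [← Finset.sum_add_distrib]
    exact Finset.sum_congr rfl fun j _ => by ring
  rw [← e4, Complex.add_re, Complex.conj_re]
  ring

/-- Let `S` be the sum and `R` the same sum with `ξ ξ_x` in place of `(ξ²)_x`. The product rule
gives `S = 2 R`, while the commutator identity with `v = ξ` gives `2 Re S = Re R`; hence `Re S = 0`.
-/
theorem re_cubic_eq_zero {F : Finset ℤ} {ξ : ℤ → ℂ} (hξ : ∀ k ∉ F, ξ k = 0)
    (hs : ∀ k, ξ (-k) = (starRingEnd ℂ) (ξ k)) :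
    (∑ k ∈ F, dsym k * conv ξ ξ k * (starRingEnd ℂ) (ξ k)).re = 0 := by
  have h := two_mul_re_commutator hξ hs
  have e : ∀ k, dsym k * conv ξ ξ k = 2 * conv ξ (fun k => dsym k * ξ k) k := by
    intro k
    have e1 : conv ξ (fun k => dsym k * ξ k) k = ∑ j ∈ F, ξ j * (dsym (k - j) * ξ (k - j)) :=
      conv_eq_sum hξ _ k
    have e2 : conv ξ (fun k => dsym k * ξ k) k = ∑ j ∈ F, dsym j * ξ j * ξ (k - j) := by
      rw [conv_comm]
      exact conv_eq_sum (fun j hj => by rw [hξ j hj, mul_zero]) _ k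
    rw [two_mul]
    nth_rewrite 1 [e1]
    rw [e2, conv_eq_sum hξ, Finset.mul_sum, ← Finset.sum_add_distrib]
    refine Finset.sum_congr rfl fun j _ => ?_
    have : dsym (k - j) = dsym k - dsym j := by simp [dsym]; ring
    rw [this]
    ring
  have e3 : ∑ k ∈ F, dsym k * conv ξ ξ k * (starRingEnd ℂ) (ξ k)
      = 2 * ∑ k ∈ F, conv ξ (fun k => dsym k * ξ k) k * (starRingEnd ℂ) (ξ k) := by
    rw [Finset.mul_sum]
    exact Finset.sum_congr rfl fun k _ => by rw [e k]; ring
  have e4 := congrArg Complex.re e3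
  rw [two_mul, Complex.add_re] at e4
  linarith

/-- Skew-adjointness of `∂_x`: its symbol is purely imaginary. -/
theorem re_dsym_cross (F : Finset ℤ) (θ ξ : ℤ → ℂ) :
    (∑ k ∈ F, dsym k * ξ k * (starRingEnd ℂ) (θ k)).re
      + (∑ k ∈ F, dsym k * θ k * (starRingEnd ℂ) (ξ k)).re = 0 := by
  rw [← Complex.add_re, ← Finset.sum_add_distrib, Complex.re_sum]
  refine Finset.sum_eq_zero fun k _ => ?_
  simp only [dsym, Complex.add_re, Complex.mul_re, Complex.mul_im, Complex.conj_re, Complex.conj_im,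
    Complex.I_re, Complex.I_im, Complex.ofReal_re, Complex.ofReal_im, Complex.intCast_re,
    Complex.intCast_im, Complex.re_ofNat, Complex.im_ofNat]
  ring

theorem L2Bd.of_wt {a : ℤ → ℂ} {A : ℝ} (h : L2Bd (fun k => wt k * a k) A) : L2Bd a A :=
  h.mono fun k => by
    rw [norm_mul, Complex.norm_real]
    exact le_mul_of_one_le_left (norm_nonneg _) ((one_le_wt k).trans (le_abs_self _))

theorem L1Bd.dsym_of_wt {a : ℤ → ℂ} {A : ℝ} (h : L1Bd (fun k => wt k * a k) A) :
    L1Bd (fun k => dsym k * a k) A :=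
  h.mono fun k => by
    rw [norm_mul, norm_mul, Complex.norm_real]
    exact mul_le_mul_of_nonneg_right ((norm_dsym_le k).trans (le_abs_self _)) (norm_nonneg _)

theorem trunc_symm {a : ℤ → ℂ} (ha : ∀ k, a (-k) = (starRingEnd ℂ) (a k)) (N : ℕ) (k : ℤ) :
    trunc N a (-k) = (starRingEnd ℂ) (trunc N a k) := by
  have : -k ∈ Finset.Icc (-(N : ℤ)) N ↔ k ∈ Finset.Icc (-(N : ℤ)) N := by
    simp only [Finset.mem_Icc]; omega
  unfold trunc
  simp only [this]
  split_ifs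
  · exact ha k
  · simp

/-- The deviation of a product from the exact one, in terms of the errors `θ, ξ` and the tails. -/
theorem conv_sub_conv {Z U θ ξ w v : ℤ → ℂ} {A B C D E G : ℝ} (hZ : L2Bd Z A) (hU : L2Bd U B)
    (hθ : L2Bd θ C) (hξ : L2Bd ξ D) (hw : L2Bd w E) (hv : L2Bd v G) (k : ℤ) :
    conv (θ + w) (ξ + v) k - conv Z U k
      = conv θ ξ k + conv θ v k + conv w ξ k - conv w (U - v) k - conv (Z - w) U k := by
  have h1 := conv_add_left hθ hw (hξ.add hv) k
  have h2 := conv_add_right hθ hξ hv k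
  have h3 := conv_add_right hw hξ hv k
  have hUv : L2Bd (U - v) (B + G) := by rw [sub_eq_add_neg]; exact hU.add hv.neg
  have hZw : L2Bd (Z - w) (A + E) := by rw [sub_eq_add_neg]; exact hZ.add hw.neg
  have h4 := conv_add_right hw hUv hv k
  have h5 := conv_add_left hZw hw hU k
  rw [sub_add_cancel] at h4 h5
  linear_combination h1 + h2 + h3 - h4 - h5

/-- The energy `κ₂ ‖θ‖² + α ‖ξ‖²` on the modes `|k| ≤ N`. -/
noncomputable def energy (κ₂ α : ℝ) (N : ℕ) (θ ξ : ℤ → ℂ) : ℝ :=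
  κ₂ * ∑ k ∈ Finset.Icc (-(N : ℤ)) N, ‖θ k‖ ^ 2 + α * ∑ k ∈ Finset.Icc (-(N : ℤ)) N, ‖ξ k‖ ^ 2

/-- The single constant works for both components because `(1/κ₂ + 1/α)(κ₂ x + α y) ≥ x + y` for `x,
y ≥ 0`. -/
theorem energy_bounds {κ₂ α : ℝ} (hκ₂ : 0 < κ₂) (hα : 0 < α) {N : ℕ} {θ ξ : ℤ → ℂ}
    (hθ : ∀ k ∉ Finset.Icc (-(N : ℤ)) N, θ k = 0) (hξ : ∀ k ∉ Finset.Icc (-(N : ℤ)) N, ξ k = 0) :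
    0 ≤ energy κ₂ α N θ ξ ∧ L2Bd θ (Real.sqrt (1 / κ₂ + 1 / α) * Real.sqrt (energy κ₂ α N θ ξ)) ∧
    L2Bd ξ (Real.sqrt (1 / κ₂ + 1 / α) * Real.sqrt (energy κ₂ α N θ ξ)) := by
  have s1 : 0 ≤ ∑ k ∈ Finset.Icc (-(N : ℤ)) N, ‖θ k‖ ^ 2 := Finset.sum_nonneg fun _ _ => by positivity
  have s2 : 0 ≤ ∑ k ∈ Finset.Icc (-(N : ℤ)) N, ‖ξ k‖ ^ 2 := Finset.sum_nonneg fun _ _ => by positivity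
  have h0 : 0 ≤ energy κ₂ α N θ ξ := by unfold energy; positivity
  have hsup : ∀ (x : ℤ → ℂ), (∀ k ∉ Finset.Icc (-(N : ℤ)) N, x k = 0) → ∀ F : Finset ℤ,
      ∑ k ∈ F, ‖x k‖ ^ 2 ≤ ∑ k ∈ Finset.Icc (-(N : ℤ)) N, ‖x k‖ ^ 2 := by
    intro x hx F
    rw [← Finset.sum_subset (Finset.inter_subset_left : F ∩ Finset.Icc (-(N : ℤ)) N ⊆ F)]
    · exact Finset.sum_le_sum_of_subset_of_nonneg Finset.inter_subset_right fun _ _ _ => by positivity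
    · intro k hk hk2
      rw [hx k fun h => hk2 (Finset.mem_inter.2 ⟨hk, h⟩)]
      simp
  refine ⟨h0, ⟨by positivity, fun F => (hsup θ hθ F).trans ?_⟩,
    ⟨by positivity, fun F => (hsup ξ hξ F).trans ?_⟩⟩ <;>
  · rw [mul_pow, Real.sq_sqrt (by positivity), Real.sq_sqrt h0]
    unfold energy
    set x := ∑ k ∈ Finset.Icc (-(N : ℤ)) N, ‖θ k‖ ^ 2
    set y := ∑ k ∈ Finset.Icc (-(N : ℤ)) N, ‖ξ k‖ ^ 2
    have e : (1 / κ₂ + 1 / α) * (κ₂ * x + α * y)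
      = x + y + (α / κ₂ * y + κ₂ / α * x) := by field_simp; ring
    rw [e]
    have : 0 ≤ α / κ₂ * y + κ₂ / α * x := by positivity
    linarith

theorem fieldZ_sub (κ₁ lam a b : ℝ) (z u Z U : ℤ → ℂ) (k : ℤ) :
    fieldZ κ₁ lam a b z u k - fieldZ κ₁ lam a b Z U k
      = (a / b : ℝ) * (dsym k * (u k - U k)) - (κ₁ + a / b : ℝ) * (msym b k * dsym k * (u k - U k))
        - lam * (msym b k * dsym k * (conv z u k - conv Z U k)) := by
  unfold fieldZ; ring

theorem fieldU_sub (κ₂ lam : ℝ) (z u Z U : ℤ → ℂ) (k : ℤ) :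
    fieldU κ₂ lam z u k - fieldU κ₂ lam Z U k
      = -(κ₂ * (dsym k * (z k - Z k))) - (lam / 2 : ℝ) * (dsym k * (conv u u k - conv U U k)) := by
  unfold fieldU; push_cast; ring

theorem re_ofReal_mul_le (r : ℝ) {w : ℂ} {W : ℝ} (h : ‖w‖ ≤ W) : -(r * w.re) ≤ |r| * W := by
  calc -(r * w.re) ≤ |r * w.re| := neg_le_abs _
    _ = |r| * |w.re| := abs_mul _ _
    _ ≤ _ := mul_le_mul_of_nonneg_left ((Complex.abs_re_le_norm w).trans h) (abs_nonneg _)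

-- The heart of the proof: the left side is the time derivative of the energy of the error, and `K`
-- depends on the exact solution only through `M`, not on `N`. The fields are compared at `θ + P Z,
-- ξ + P U` and at the untruncated `Z, U`, so the consistency error is included.
set_option maxHeartbeats 1000000 in
theorem exists_energy_estimate {κ₁ κ₂ lam a b μ M : ℝ} (hκ₂ : 0 < κ₂) (ha : a < 0) (hb : 0 < b)
    (hμ : 3 / 2 < μ) (hM : 0 ≤ M) :
    ∃ K : ℝ, 0 ≤ K ∧ ∀ N : ℕ, 1 ≤ N → ∀ Z U θ ξ : ℤ → ℂ, SobBd μ Z M → SobBd μ U M →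
      (∀ k, U (-k) = (starRingEnd ℂ) (U k)) → (∀ k, ξ (-k) = (starRingEnd ℂ) (ξ k)) →
      (∀ k ∉ Finset.Icc (-(N : ℤ)) N, θ k = 0) → (∀ k ∉ Finset.Icc (-(N : ℤ)) N, ξ k = 0) →
      energy κ₂ (-(a / b)) N θ ξ ≤ 1 →
      2 * (κ₂ * (∑ k ∈ Finset.Icc (-(N : ℤ)) N,
          (fieldZ κ₁ lam a b (θ + trunc N Z) (ξ + trunc N U) k - fieldZ κ₁ lam a b Z U k)
            * (starRingEnd ℂ) (θ k)).re
        + -(a / b) * (∑ k ∈ Finset.Icc (-(N : ℤ)) N,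
          (fieldU κ₂ lam (θ + trunc N Z) (ξ + trunc N U) k - fieldU κ₂ lam Z U k)
            * (starRingEnd ℂ) (ξ k)).re)
        ≤ K * (energy κ₂ (-(a / b)) N θ ξ + ((N : ℝ) ^ (1 - μ)) ^ 2) := by
  obtain ⟨C, hC0, hC⟩ := exists_weight_l1 hμ
  obtain ⟨B, hB⟩ := exists_msym_bound hb
  have hB0 := hB.1
  set α := -(a / b) with hαdef
  have hα : 0 < α := by rw [hαdef, ← neg_div]; exact div_pos (neg_pos.2 ha) hb
  have hab : a / b = -α := by rw [hαdef, neg_neg]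
  set c := Real.sqrt (1 / κ₂ + 1 / α) with hc
  have hc0 : 0 ≤ c := Real.sqrt_nonneg _
  set β := κ₁ + a / b with hβ
  -- `K1` collects the coefficients of `s²` and `K2` those of `s ε`, where `s` bounds the `ℓ²` norms
  -- of `θ, ξ` and `ε = N^{1-μ}`.
  set K1 := 2 * (κ₂ * (|β| * B) + κ₂ * (|lam| * (B * (c + 2 * M))) + α * (|lam / 2| * (C * M))) with hK1
  set K2 := 2 * (κ₂ * (|lam| * (B * (2 * M * (2 * Real.pi * M))))
    + α * (|lam / 2| * (2 * (2 * Real.pi * M * (C * M))))) with hK2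
  have hK1' : 0 ≤ K1 := by positivity
  have hK2' : 0 ≤ K2 := by positivity
  refine ⟨(K1 + K2) * c ^ 2 + K2, by positivity, ?_⟩
  intro N hN Z U θ ξ hZ hU hUs hξs hθ0 hξ0 hE
  obtain ⟨hE0, hθ, hξ⟩ := energy_bounds hκ₂ hα hθ0 hξ0
  rw [← hc] at hθ hξ
  set E := energy κ₂ α N θ ξ
  set s := c * Real.sqrt E with hs
  have hs0 : 0 ≤ s := by positivity
  have hsq : s ^ 2 = c ^ 2 * E := by rw [hs, mul_pow, Real.sq_sqrt hE0]
  -- The only use of `E ≤ 1`: it makes the quadratic term `θ ξ` of the first equation linear in `s`.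
  -- The quadratic term of the second equation needs no smallness, as it cancels.
  have hsc : s ≤ c := mul_le_of_le_one_right hc0 (Real.sqrt_le_one.2 hE)
  set ε := (N : ℝ) ^ (1 - μ) with hε
  have hε0 : 0 ≤ ε := by positivity
  set w := trunc N Z with hw
  set v := trunc N U with hv
  set I := Finset.Icc (-(N : ℤ)) N with hI
  have hμ0 : 0 ≤ μ := by linarith
  have hZ2 := hZ.l2 hμ0
  have hU2 := hU.l2 hμ0
  have hw2 := (hZ.trunc N).l2 hμ0
  have hv2 := (hU.trunc N).l2 hμ0
  have hrW := hU.tail (by linarith) hN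
  have hqW := hZ.tail (by linarith) hN
  have hUW := hC U M hU
  have hvW := hC v M (hU.trunc N)
  set ε₁ := 2 * Real.pi * M * ε with hε₁
  have hε₁0 : 0 ≤ ε₁ := by positivity
  have hr2 : L2Bd (U - v) ε₁ := hrW.of_wt
  have hq2 : L2Bd (Z - w) ε₁ := hqW.of_wt
  have hx : ∀ k, ‖conv (θ + w) (ξ + v) k - conv Z U k‖ ≤ s * s + s * M + M * s + M * ε₁ + ε₁ * M := by
    intro k
    rw [conv_sub_conv hZ2 hU2 hθ hξ hw2 hv2]
    refine (norm_sub_le _ _).trans (add_le_add ((norm_sub_le _ _).trans (add_le_add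
      ((norm_add_le _ _).trans (add_le_add ((norm_add_le _ _).trans (add_le_add ?_ ?_)) ?_)) ?_)) ?_)
    · exact hθ.norm_conv_le hξ k
    · exact hθ.norm_conv_le hv2 k
    · exact hw2.norm_conv_le hξ k
    · exact hw2.norm_conv_le hr2 k
    · exact hq2.norm_conv_le hU2 k
  set X := s * s + s * M + M * s + M * ε₁ + ε₁ * M with hX
  have hIv : ∀ k ∈ I, (ξ + v) k - U k = ξ k := by
    intro k hk
    rw [Pi.add_apply, hv, trunc, if_pos hk, add_sub_cancel_right]
  have hIw : ∀ k ∈ I, (θ + w) k - Z k = θ k := by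
    intro k hk
    rw [Pi.add_apply, hw, trunc, if_pos hk, add_sub_cancel_right]
  set P1 := ∑ k ∈ I, dsym k * ξ k * (starRingEnd ℂ) (θ k) with hP1
  set P2 := ∑ k ∈ I, dsym k * θ k * (starRingEnd ℂ) (ξ k) with hP2
  set R1 := ∑ k ∈ I, msym b k * dsym k * ξ k * (starRingEnd ℂ) (θ k) with hR1
  set R2 := ∑ k ∈ I, msym b k * dsym k * (conv (θ + w) (ξ + v) k - conv Z U k)
    * (starRingEnd ℂ) (θ k) with hR2
  set Q0 := ∑ k ∈ I, dsym k * conv ξ ξ k * (starRingEnd ℂ) (ξ k) with hQ0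
  set Q1 := ∑ k ∈ I, dsym k * conv ξ v k * (starRingEnd ℂ) (ξ k) with hQ1
  set Q2 := ∑ k ∈ I, dsym k * conv (U - v) v k * (starRingEnd ℂ) (ξ k) with hQ2
  set Q3 := ∑ k ∈ I, dsym k * conv (U - v) U k * (starRingEnd ℂ) (ξ k) with hQ3
  have S1 : ∑ k ∈ I, (fieldZ κ₁ lam a b (θ + w) (ξ + v) k - fieldZ κ₁ lam a b Z U k)
      * (starRingEnd ℂ) (θ k) = ((a / b : ℝ) : ℂ) * P1 - (β : ℂ) * R1 - lam * R2 := by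
    rw [hP1, hR1, hR2, Finset.mul_sum, Finset.mul_sum, Finset.mul_sum, ← Finset.sum_sub_distrib,
      ← Finset.sum_sub_distrib]
    refine Finset.sum_congr rfl fun k hk => ?_
    rw [fieldZ_sub, hIv k hk]
    ring
  have S2 : ∑ k ∈ I, (fieldU κ₂ lam (θ + w) (ξ + v) k - fieldU κ₂ lam Z U k)
      * (starRingEnd ℂ) (ξ k)
      -- The two mixed products `ξ v` and `v ξ` coincide; the double `Q1` is exactly what the
      -- commutator identity evaluates.
      = ((-κ₂ : ℝ) : ℂ) * P2 - ((lam / 2 : ℝ) : ℂ) * (Q0 + (Q1 + Q1) - Q2 - Q3) := by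
    rw [hP2, hQ0, hQ1, hQ2, hQ3, ← Finset.sum_add_distrib, ← Finset.sum_add_distrib,
      ← Finset.sum_sub_distrib, ← Finset.sum_sub_distrib, Finset.mul_sum, Finset.mul_sum,
      ← Finset.sum_sub_distrib]
    refine Finset.sum_congr rfl fun k hk => ?_
    rw [fieldU_sub, hIw k hk, conv_sub_conv hU2 hU2 hξ hξ hv2 hv2, conv_comm v ξ, conv_comm v (U - v)]
    push_cast
    ring
  have b1 : P1.re + P2.re = 0 := re_dsym_cross I θ ξ
  have b2 : ‖R1‖ ≤ s * (B * s) := norm_sum_mul_conj_le hB (fun k => hξ.norm_le k) hθ I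
  have b3 : ‖R2‖ ≤ X * (B * s) := norm_sum_mul_conj_le hB hx hθ I
  have b4 : Q0.re = 0 := re_cubic_eq_zero hξ0 hξs
  have b5 : 2 * Q1.re = (∑ k ∈ I, conv ξ (fun k => dsym k * v k) k * (starRingEnd ℂ) (ξ k)).re :=
    two_mul_re_commutator hξ0 (trunc_symm hUs N)
  have b6 := norm_sum_conv_conj_le hξ hξ hvW.dsym_of_wt I
  have b7 : ‖Q2‖ ≤ ε₁ * s * (C * M) := norm_sum_dsym_conv_conj_le hrW hξ hvW I
  have b8 : ‖Q3‖ ≤ ε₁ * s * (C * M) := norm_sum_dsym_conv_conj_le hrW hξ hUW I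
  set Q1' := ∑ k ∈ I, conv ξ (fun k => dsym k * v k) k * (starRingEnd ℂ) (ξ k)
  rw [S1, S2]
  simp only [Complex.sub_re, Complex.re_ofReal_mul, Complex.add_re]
  have d1 := re_ofReal_mul_le β b2
  have d2 := re_ofReal_mul_le lam b3
  have d3 := re_ofReal_mul_le (lam / 2) b6
  have d4 := re_ofReal_mul_le (-(lam / 2)) b7
  have d5 := re_ofReal_mul_le (-(lam / 2)) b8
  rw [abs_neg] at d4 d5
  have hX' : X ≤ (c + 2 * M) * s + 2 * M * ε₁ := by
    have := mul_le_mul_of_nonneg_right hsc hs0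
    rw [hX]; linarith
  have d2' : -(lam * R2.re) ≤ |lam| * (((c + 2 * M) * s + 2 * M * ε₁) * (B * s)) :=
    d2.trans (by gcongr)
  have key : 2 * (κ₂ * (a / b * P1.re - β * R1.re - lam * R2.re)
      + α * (-κ₂ * P2.re - lam / 2 * (Q0.re + (Q1.re + Q1.re) - Q2.re - Q3.re)))
      ≤ K1 * s ^ 2 + K2 * (s * ε) := by
    -- With `a / b = -α`, the terms `P1` and `P2` carry the common factor `-κ₂ α` and cancel. This
    -- is the reason for the weights in the energy.
    have e1 : 2 * (κ₂ * (a / b * P1.re - β * R1.re - lam * R2.re)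
      + α * (-κ₂ * P2.re - lam / 2 * (Q0.re + (Q1.re + Q1.re) - Q2.re - Q3.re)))
      = 2 * (κ₂ * (-(β * R1.re)) + κ₂ * (-(lam * R2.re)) + α * (-(lam / 2 * Q1'.re)
        + -(-(lam / 2) * Q2.re) + -(-(lam / 2) * Q3.re))) := by
      rw [hab, b4, ← b5]
      linear_combination (-2 * κ₂ * α) * b1
    rw [e1]
    have f1 := mul_le_mul_of_nonneg_left d1 hκ₂.le
    have f2 := mul_le_mul_of_nonneg_left d2' hκ₂.le
    have f3 := mul_le_mul_of_nonneg_left (add_le_add (add_le_add d3 d4) d5) hα.le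
    refine (mul_le_mul_of_nonneg_left (add_le_add (add_le_add f1 f2) f3) zero_le_two).trans
      (le_of_eq ?_)
    rw [hK1, hK2, hε₁]
    ring
  refine key.trans ?_
  have hsε : s * ε ≤ s ^ 2 + ε ^ 2 := by
    have h1 := sq_nonneg (s - ε)
    have h2 := sq_nonneg s
    have h3 := sq_nonneg ε
    rw [sub_sq] at h1
    linarith
  calc K1 * s ^ 2 + K2 * (s * ε) ≤ K1 * s ^ 2 + K2 * (s ^ 2 + ε ^ 2) := by gcongr
    _ = (K1 + K2) * c ^ 2 * E + K2 * ε ^ 2 := by rw [hsq]; ring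
    _ ≤ _ := by
        have : 0 ≤ K2 * E + (K1 + K2) * c ^ 2 * ε ^ 2 := by positivity
        linarith

/-! ### Ordinary differential equations -/

theorem hasDerivWithinAt_Ici_of_Icc {E : Type*} [NormedAddCommGroup E] [NormedSpace ℝ E] {f : ℝ → E}
    {f' : E} {a b t : ℝ} (h : HasDerivWithinAt f f' (Icc a b) t) (ht : t ∈ Ico a b) :
    HasDerivWithinAt f f' (Ici t) t :=
  h.mono_of_mem_nhdsWithin (mem_nhdsGE_iff_exists_Icc_subset.2
    ⟨b, ht.2, Icc_subset_Icc_left ht.1⟩)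

/-- A differential inequality that holds while `E ≤ 1`, with small data, keeps `E` small. -/
theorem le_of_deriv_le_of_le_one {E E' : ℝ → ℝ} {T K ε : ℝ} (hK : 0 ≤ K) (hε : 0 < ε)
    (hE : ∀ t ∈ Icc (0 : ℝ) T, HasDerivWithinAt E (E' t) (Icc 0 T) t) (h0 : E 0 = 0)
    (hb : ∀ t ∈ Icc (0 : ℝ) T, E t ≤ 1 → E' t ≤ K * (E t + ε ^ 2))
    (hs : (K + 1) * ε ^ 2 * Real.exp ((K + 1) * T) ≤ 1) :
    ∀ t ∈ Icc (0 : ℝ) T, E t ≤ (K + 1) * ε ^ 2 * Real.exp ((K + 1) * T) := by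
  -- The barrier is `δ e^{(K+1)t}`. Replacing `K` by `K + 1` leaves room for a strict inequality at
  -- a contact point.
  set δ := (K + 1) * ε ^ 2 with hδ
  have hδ0 : 0 < δ := by positivity
  have hmono : ∀ t ∈ Icc (0 : ℝ) T,
      δ * Real.exp ((K + 1) * t) ≤ δ * Real.exp ((K + 1) * T) := fun t ht =>
    mul_le_mul_of_nonneg_left (Real.exp_le_exp.2
      (mul_le_mul_of_nonneg_left ht.2 (by linarith))) hδ0.le
  have hB : ∀ t : ℝ, HasDerivAt (fun t => δ * Real.exp ((K + 1) * t))
      (δ * (Real.exp ((K + 1) * t) * (K + 1))) t := fun t => by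
    have := ((hasDerivAt_id t).const_mul (K + 1)).exp.const_mul δ
    simpa using this
  have h := image_le_of_deriv_right_lt_deriv_boundary
    (f := E) (f' := E') (a := 0) (b := T) (fun t ht => (hE t ht).continuousWithinAt)
    (fun t ht => hasDerivWithinAt_Ici_of_Icc (hE t (Ico_subset_Icc_self ht)) ht)
    (by simp [h0, hδ0.le]) hB ?_
  · intro t ht
    exact (h ht).trans (hmono t ht)
  -- At contact the barrier is at most one, so the differential inequality is available. Since `E ≥
  -- δ > K ε²` there, `K (E + ε²) < (K + 1) E`, the slope of the barrier.
  · intro t ht hEq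
    have ht' := Ico_subset_Icc_self ht
    have h1 : E t ≤ 1 := hEq.trans_le ((hmono t ht').trans hs)
    have h2 := hb t ht' h1
    have h3 : δ ≤ E t := by
      rw [hEq]
      exact le_mul_of_one_le_right hδ0.le (Real.one_le_exp (mul_nonneg (by linarith) ht.1))
    have e : δ * (Real.exp ((K + 1) * t) * (K + 1)) = (K + 1) * E t := by rw [hEq]; ring
    rw [e]
    have h4 : K * ε ^ 2 < δ := by rw [hδ]; nlinarith [sq_pos_of_pos hε]
    linarith

/-- A `C¹` field times a smooth bump has compact support, hence is bounded and globally Lipschitz;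
the bump equals one on the ball of radius `r`. -/
theorem exists_cutoff {V : Type*} [NormedAddCommGroup V] [NormedSpace ℝ V] [FiniteDimensional ℝ V]
    {F : V → V} (hF : ContDiff ℝ 1 F) {r : ℝ} (hr : 0 < r) :
    ∃ (G : V → V) (K L : NNReal), LipschitzWith K G ∧ (∀ y, ‖G y‖ ≤ L) ∧
      ∀ y, ‖y‖ ≤ r → G y = F y := by
  let ψ : ContDiffBump (0 : V) := ⟨r, r + 1, hr, by linarith⟩
  have hc : HasCompactSupport fun y => ψ y • F y := ψ.hasCompactSupport.smul_right
  have hd : ContDiff ℝ 1 fun y => ψ y • F y := ψ.contDiff.smul hF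
  obtain ⟨K, hK⟩ := ContDiff.lipschitzWith_of_hasCompactSupport hc hd one_ne_zero
  obtain ⟨L, hL⟩ := hc.exists_bound_of_continuous hd.continuous
  refine ⟨_, K, L.toNNReal, hK, fun y => (hL y).trans (Real.le_coe_toNNReal L), fun y hy => ?_⟩
  rw [ψ.one_of_mem_closedBall (by simpa using hy), one_smul]

/-- Because `G` is bounded by `L` everywhere, Picard–Lindelöf on the ball of radius `L T` reaches
all of `[0, T]` in one step. -/
theorem exists_solution_of_lipschitz {V : Type*} [NormedAddCommGroup V] [NormedSpace ℝ V]
    [CompleteSpace V] {G : V → V} {K L : NNReal} (hG : LipschitzWith K G) (hL : ∀ y, ‖G y‖ ≤ L)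
    {T : ℝ} (hT : 0 ≤ T) (y₀ : V) :
    ∃ y : ℝ → V, y 0 = y₀ ∧ ∀ t ∈ Icc (0 : ℝ) T, HasDerivWithinAt y (G (y t)) (Icc 0 T) t := by
  have h : IsPicardLindelof (fun _ => G) (tmin := 0) (tmax := T) ⟨0, left_mem_Icc.2 hT⟩ y₀
      (L * ⟨T, hT⟩) 0 L K :=
    { lipschitzOnWith := fun _ _ => hG.lipschitzOnWith
      continuousOn := fun _ _ => continuousOn_const
      norm_le := fun _ _ y _ => hL y
      mul_max_le := by
        change (L : ℝ) * max (T - 0) (0 - 0) ≤ (L : ℝ) * T - 0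
        simp [hT] }
  exact h.exists_eq_forall_mem_Icc_hasDerivWithinAt₀

/-- Solutions of an autonomous equation with a `C¹` right hand side are unique. -/
theorem solution_unique {V : Type*} [NormedAddCommGroup V] [NormedSpace ℝ V] [FiniteDimensional ℝ V]
    {F : V → V} (hF : ContDiff ℝ 1 F) {T : ℝ} {y y' : ℝ → V}
    (hy : ∀ t ∈ Icc (0 : ℝ) T, HasDerivWithinAt y (F (y t)) (Icc 0 T) t)
    (hy' : ∀ t ∈ Icc (0 : ℝ) T, HasDerivWithinAt y' (F (y' t)) (Icc 0 T) t) (h0 : y 0 = y' 0) :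
    EqOn y y' (Icc 0 T) := by
  have hc : ContinuousOn y (Icc 0 T) := fun t ht => (hy t ht).continuousWithinAt
  have hc' : ContinuousOn y' (Icc 0 T) := fun t ht => (hy' t ht).continuousWithinAt
  obtain ⟨r, hr⟩ := isCompact_Icc.exists_bound_of_continuousOn hc
  obtain ⟨r', hr'⟩ := isCompact_Icc.exists_bound_of_continuousOn hc'
  -- Both solutions stay in this ball by compactness, so they solve the same globally Lipschitz
  -- equation. The `1` only makes the radius positive.
  obtain ⟨G, K, L, hK, -, hG⟩ := exists_cutoff hF (r := max (max r r') 1) (by positivity)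
  refine ODE_solution_unique_of_mem_Icc_right (v := fun _ => G) (s := fun _ => univ) (K := K)
    (fun _ _ => hK.lipschitzOnWith) hc (fun t ht => ?_) (fun _ _ => mem_univ _) hc' (fun t ht => ?_)
    (fun _ _ => mem_univ _) h0
  · have ht' := Ico_subset_Icc_self ht
    rw [hG _ ((hr t ht').trans ((le_max_left _ _).trans (le_max_left _ _)))]
    exact hasDerivWithinAt_Ici_of_Icc (hy t ht') ht
  · have ht' := Ico_subset_Icc_self ht
    rw [hG _ ((hr' t ht').trans ((le_max_right _ _).trans (le_max_left _ _)))]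
    exact hasDerivWithinAt_Ici_of_Icc (hy' t ht') ht

/-! ### The system of modes as an ordinary differential equation -/

/-- The modes `|k| ≤ N`. -/
abbrev Modes (N : ℕ) : Type := ↥(Finset.Icc (-(N : ℤ)) N) → ℂ

/-- Extension of a finite family of modes by zero. -/
noncomputable def extend {N : ℕ} (y : Modes N) (k : ℤ) : ℂ :=
  if h : k ∈ Finset.Icc (-(N : ℤ)) N then y ⟨k, h⟩ else 0

/-- Restriction of a sequence to the modes `|k| ≤ N`. -/
def restrict (N : ℕ) (a : ℤ → ℂ) : Modes N := fun k => a k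

theorem extend_of_mem {N : ℕ} (y : Modes N) {k : ℤ} (h : k ∈ Finset.Icc (-(N : ℤ)) N) :
    extend y k = y ⟨k, h⟩ := dif_pos h

theorem extend_of_notMem {N : ℕ} (y : Modes N) {k : ℤ} (h : k ∉ Finset.Icc (-(N : ℤ)) N) :
    extend y k = 0 := dif_neg h

theorem extend_restrict {N : ℕ} {a : ℤ → ℂ} (ha : ∀ k ∉ Finset.Icc (-(N : ℤ)) N, a k = 0) :
    extend (restrict N a) = a := by
  funext k
  by_cases h : k ∈ Finset.Icc (-(N : ℤ)) N
  · rw [extend_of_mem _ h, restrict]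
  · rw [extend_of_notMem _ h, ha k h]

/-- The right hand side of the system of modes. -/
noncomputable def modeField (κ₁ κ₂ lam a b : ℝ) (N : ℕ) (y : Modes N × Modes N) :
    Modes N × Modes N :=
  (restrict N (fieldZ κ₁ lam a b (extend y.1) (extend y.2)),
    restrict N (fieldU κ₂ lam (extend y.1) (extend y.2)))

theorem contDiff_extend_fst {N : ℕ} (k : ℤ) :
    ContDiff ℝ 1 fun y : Modes N × Modes N => extend y.1 k := by
  by_cases h : k ∈ Finset.Icc (-(N : ℤ)) N
  · simp only [extend_of_mem _ h]
    fun_prop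
  · simp only [extend_of_notMem _ h]
    fun_prop

theorem contDiff_extend_snd {N : ℕ} (k : ℤ) :
    ContDiff ℝ 1 fun y : Modes N × Modes N => extend y.2 k := by
  by_cases h : k ∈ Finset.Icc (-(N : ℤ)) N
  · simp only [extend_of_mem _ h]
    fun_prop
  · simp only [extend_of_notMem _ h]
    fun_prop

theorem conv_extend {N : ℕ} (y : Modes N) (b : ℤ → ℂ) (k : ℤ) :
    conv (extend y) b k = ∑ j ∈ Finset.Icc (-(N : ℤ)) N, extend y j * b (k - j) :=
  conv_eq_sum (fun _ h => extend_of_notMem y h) b k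

theorem contDiff_modeField (κ₁ κ₂ lam a b : ℝ) (N : ℕ) :
    ContDiff ℝ 1 (modeField κ₁ κ₂ lam a b N) := by
  have h1 := fun k => contDiff_extend_fst (N := N) k
  have h2 := fun k => contDiff_extend_snd (N := N) k
  refine ContDiff.prodMk (contDiff_pi.2 fun k => ?_) (contDiff_pi.2 fun k => ?_)
  · simp only [restrict, fieldZ, conv_extend]
    refine ((contDiff_const.mul (contDiff_const.mul (h2 _))).sub (contDiff_const.mul
      (contDiff_const.mul (contDiff_const.mul (h2 _))))).sub (contDiff_const.mul (contDiff_const.mul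
      (contDiff_const.mul (ContDiff.sum fun j _ => (h1 _).mul (h2 _)))))
  · simp only [restrict, fieldU, conv_extend]
    exact (contDiff_const.mul (contDiff_const.mul (h1 _))).neg.sub (contDiff_const.mul
      (contDiff_const.mul (contDiff_const.mul (ContDiff.sum fun j _ => (h2 _).mul (h2 _)))))

theorem IsModeSolution.hasDerivWithinAt_restrict {κ₁ κ₂ lam a b T : ℝ} {z₀ u₀ : ℤ → ℂ} {N : ℕ}
    {z u : ℝ → ℤ → ℂ} (h : IsModeSolution κ₁ κ₂ lam a b T z₀ u₀ N z u) {t : ℝ}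
    (ht : t ∈ Icc (0 : ℝ) T) :
    HasDerivWithinAt (fun t => (restrict N (z t), restrict N (u t)))
      (modeField κ₁ κ₂ lam a b N (restrict N (z t), restrict N (u t))) (Icc 0 T) t := by
  unfold modeField
  simp only
  rw [extend_restrict fun k hk => (h.supp t ht k hk).1,
    extend_restrict fun k hk => (h.supp t ht k hk).2]
  have hz : HasDerivWithinAt (fun t => restrict N (z t))
      (restrict N (fieldZ κ₁ lam a b (z t) (u t))) (Icc 0 T) t :=
    hasDerivWithinAt_pi.2 fun k => h.deriv_z t ht k k.2
  have hu : HasDerivWithinAt (fun t => restrict N (u t))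
      (restrict N (fieldU κ₂ lam (z t) (u t))) (Icc 0 T) t :=
    hasDerivWithinAt_pi.2 fun k => h.deriv_u t ht k k.2
  exact hz.prodMk hu

theorem IsModeSolution.unique {κ₁ κ₂ lam a b T : ℝ} {z₀ u₀ : ℤ → ℂ} {N : ℕ}
    {z u z' u' : ℝ → ℤ → ℂ} (h : IsModeSolution κ₁ κ₂ lam a b T z₀ u₀ N z u)
    (h' : IsModeSolution κ₁ κ₂ lam a b T z₀ u₀ N z' u') {t : ℝ} (ht : t ∈ Icc (0 : ℝ) T) :
    z t = z' t ∧ u t = u' t := by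
  have e := solution_unique (contDiff_modeField κ₁ κ₂ lam a b N)
    (fun s hs => h.hasDerivWithinAt_restrict hs) (fun s hs => h'.hasDerivWithinAt_restrict hs) ?_ ht
  · simp only [Prod.mk.injEq] at e
    constructor
    · rw [← extend_restrict fun k hk => (h.supp t ht k hk).1, e.1,
        extend_restrict fun k hk => (h'.supp t ht k hk).1]
    · rw [← extend_restrict fun k hk => (h.supp t ht k hk).2, e.2,
        extend_restrict fun k hk => (h'.supp t ht k hk).2]
  · simp only [Prod.mk.injEq]
    constructor <;> funext k
    · exact ((h.init k k.2).1).trans ((h'.init k k.2).1).symm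
    · exact ((h.init k k.2).2).trans ((h'.init k k.2).2).symm

/-! ### Reality of the modes -/

theorem neg_mem_Icc {N : ℕ} {k : ℤ} (h : k ∈ Finset.Icc (-(N : ℤ)) N) :
    -k ∈ Finset.Icc (-(N : ℤ)) N := by
  simp only [Finset.mem_Icc] at *; omega

/-- The real-linear projection onto the modes of real functions. -/
noncomputable def symmetrize (N : ℕ) : Modes N →L[ℝ] Modes N :=
  ContinuousLinearMap.pi fun k : ↥(Finset.Icc (-(N : ℤ)) N) => (1 / 2 : ℝ) •
    ((ContinuousLinearMap.proj k : Modes N →L[ℝ] ℂ) + (Complex.conjCLE : ℂ →L[ℝ] ℂ).comp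
      (ContinuousLinearMap.proj (⟨-k, neg_mem_Icc k.2⟩ : ↥(Finset.Icc (-(N : ℤ)) N))
        : Modes N →L[ℝ] ℂ))

theorem extend_symmetrize {N : ℕ} (y : Modes N) (k : ℤ) :
    extend (symmetrize N y) k = 1 / 2 * (extend y k + (starRingEnd ℂ) (extend y (-k))) := by
  by_cases h : k ∈ Finset.Icc (-(N : ℤ)) N
  · rw [extend_of_mem _ h, extend_of_mem _ h, extend_of_mem _ (neg_mem_Icc h)]
    simp [symmetrize, mul_add]
  · have h' : -k ∉ Finset.Icc (-(N : ℤ)) N := fun hk => h (by simpa using neg_mem_Icc hk)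
    rw [extend_of_notMem _ h, extend_of_notMem _ h, extend_of_notMem _ h']
    simp

theorem extend_symmetrize_neg {N : ℕ} (y : Modes N) (k : ℤ) :
    extend (symmetrize N y) (-k) = (starRingEnd ℂ) (extend (symmetrize N y) k) := by
  rw [extend_symmetrize, extend_symmetrize, neg_neg, map_mul, map_add, Complex.conj_conj, map_div₀,
    map_one, map_ofNat, add_comm]

theorem extend_symmetrize_of_symm {N : ℕ} {y : Modes N}
    (hy : ∀ k, extend y (-k) = (starRingEnd ℂ) (extend y k)) :
    extend (symmetrize N y) = extend y := by
  funext k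
  rw [extend_symmetrize, hy, Complex.conj_conj]
  ring

theorem conv_neg_index {a b : ℤ → ℂ} (ha : ∀ k, a (-k) = (starRingEnd ℂ) (a k))
    (hb : ∀ k, b (-k) = (starRingEnd ℂ) (b k)) (k : ℤ) :
    conv a b (-k) = (starRingEnd ℂ) (conv a b k) := by
  unfold conv
  rw [Complex.conj_tsum, ← (Equiv.neg ℤ).tsum_eq]
  refine tsum_congr fun j => ?_
  rw [Equiv.neg_apply, map_mul, ← ha, ← hb]
  congr 2
  ring

theorem msym_neg (b : ℝ) (k : ℤ) : msym b (-k) = msym b k := by simp [msym]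

theorem conj_msym (b : ℝ) (k : ℤ) : (starRingEnd ℂ) (msym b k) = msym b k := by
  rw [msym, map_div₀, map_one, Complex.conj_ofReal]

/-- `dsym` is odd and imaginary, `msym` even and real, so the field preserves the reality condition;
on real modes `symmetrize` therefore leaves it unchanged. -/
theorem fieldZ_neg_index {z u : ℤ → ℂ} (hz : ∀ k, z (-k) = (starRingEnd ℂ) (z k))
    (hu : ∀ k, u (-k) = (starRingEnd ℂ) (u k)) (κ₁ lam a b : ℝ) (k : ℤ) :
    fieldZ κ₁ lam a b z u (-k) = (starRingEnd ℂ) (fieldZ κ₁ lam a b z u k) := by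
  unfold fieldZ
  simp only [map_sub, map_mul, Complex.conj_ofReal, conj_dsym, conj_msym, dsym_neg, msym_neg,
    ← hu, ← conv_neg_index hz hu]

theorem fieldU_neg_index {z u : ℤ → ℂ} (hz : ∀ k, z (-k) = (starRingEnd ℂ) (z k))
    (hu : ∀ k, u (-k) = (starRingEnd ℂ) (u k)) (κ₂ lam : ℝ) (k : ℤ) :
    fieldU κ₂ lam z u (-k) = (starRingEnd ℂ) (fieldU κ₂ lam z u k) := by
  unfold fieldU
  simp only [map_sub, map_neg, map_mul, map_div₀, map_one, map_ofNat, Complex.conj_ofReal,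
    conj_dsym, dsym_neg, ← hz, ← conv_neg_index hu hu]

/-! ### Error of the semidiscrete solution -/

theorem hasDerivWithinAt_energy {κ₂ α : ℝ} {N : ℕ} {θ ξ : ℝ → ℤ → ℂ} {dθ dξ : ℤ → ℂ} {s : Set ℝ}
    {t : ℝ} (hθ : ∀ k ∈ Finset.Icc (-(N : ℤ)) N, HasDerivWithinAt (fun r => θ r k) (dθ k) s t)
    (hξ : ∀ k ∈ Finset.Icc (-(N : ℤ)) N, HasDerivWithinAt (fun r => ξ r k) (dξ k) s t) :
    HasDerivWithinAt (fun r => energy κ₂ α N (θ r) (ξ r))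
      (2 * (κ₂ * (∑ k ∈ Finset.Icc (-(N : ℤ)) N, dθ k * (starRingEnd ℂ) (θ t k)).re
        + α * (∑ k ∈ Finset.Icc (-(N : ℤ)) N, dξ k * (starRingEnd ℂ) (ξ t k)).re)) s t := by
  have key : ∀ {x : ℝ → ℤ → ℂ} {dx : ℤ → ℂ},
      (∀ k ∈ Finset.Icc (-(N : ℤ)) N, HasDerivWithinAt (fun r => x r k) (dx k) s t) →
      HasDerivWithinAt (fun r => ∑ k ∈ Finset.Icc (-(N : ℤ)) N, ‖x r k‖ ^ 2)
        (2 * (∑ k ∈ Finset.Icc (-(N : ℤ)) N, dx k * (starRingEnd ℂ) (x t k)).re) s t := by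
    intro x dx hx
    rw [Complex.re_sum, Finset.mul_sum]
    exact HasDerivWithinAt.fun_sum fun k hk => (hx k hk).norm_sq
  have h := ((key hθ).const_mul κ₂).add ((key hξ).const_mul α)
  refine h.congr_deriv ?_
  ring

/-- The Fourier coefficients `Z, U` of an exact solution, bounded by `M` in `H^μ`. -/
structure IsExactModes (κ₁ κ₂ lam a b μ M T : ℝ) (Z U : ℝ → ℤ → ℂ) : Prop where
  bound : ∀ t ∈ Icc (0 : ℝ) T, SobBd μ (Z t) M ∧ SobBd μ (U t) M
  symm : ∀ t ∈ Icc (0 : ℝ) T, ∀ k,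
    Z t (-k) = (starRingEnd ℂ) (Z t k) ∧ U t (-k) = (starRingEnd ℂ) (U t k)
  deriv_Z : ∀ t ∈ Icc (0 : ℝ) T, ∀ k,
    HasDerivWithinAt (fun s => Z s k) (fieldZ κ₁ lam a b (Z t) (U t) k) (Icc 0 T) t
  deriv_U : ∀ t ∈ Icc (0 : ℝ) T, ∀ k,
    HasDerivWithinAt (fun s => U s k) (fieldU κ₂ lam (Z t) (U t) k) (Icc 0 T) t

theorem hasDerivWithinAt_sub_trunc {N : ℕ} {z Z : ℝ → ℤ → ℂ} {dz dZ : ℂ} {s : Set ℝ} {t : ℝ} {k : ℤ}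
    (hk : k ∈ Finset.Icc (-(N : ℤ)) N) (hz : HasDerivWithinAt (fun r => z r k) dz s t)
    (hZ : HasDerivWithinAt (fun r => Z r k) dZ s t) :
    HasDerivWithinAt (fun r => (z r - trunc N (Z r)) k) (dz - dZ) s t := by
  simp only [Pi.sub_apply, trunc, if_pos hk]
  exact hz.sub hZ

/-- If `z, u` solves the system of modes as long as its error is at most one, then its error is
`O(N^{1-μ})`. -/
theorem exists_energy_le {κ₁ κ₂ lam a b μ M T : ℝ} (hκ₂ : 0 < κ₂) (ha : a < 0) (hb : 0 < b)
    (hμ : 3 / 2 < μ) (hM : 0 ≤ M) (hT : 0 < T) :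
    ∃ K : ℝ, 0 ≤ K ∧ ∀ Z U : ℝ → ℤ → ℂ, IsExactModes κ₁ κ₂ lam a b μ M T Z U → ∀ N : ℕ, 1 ≤ N →
      (K + 1) * ((N : ℝ) ^ (1 - μ)) ^ 2 * Real.exp ((K + 1) * T) ≤ 1 →
      ∀ z u dz du : ℝ → ℤ → ℂ,
      (∀ t ∈ Icc (0 : ℝ) T, ∀ k ∉ Finset.Icc (-(N : ℤ)) N, z t k = 0 ∧ u t k = 0) →
      (∀ t ∈ Icc (0 : ℝ) T, ∀ k, u t (-k) = (starRingEnd ℂ) (u t k)) →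
      (∀ k ∈ Finset.Icc (-(N : ℤ)) N, z 0 k = Z 0 k ∧ u 0 k = U 0 k) →
      (∀ t ∈ Icc (0 : ℝ) T, ∀ k ∈ Finset.Icc (-(N : ℤ)) N,
        HasDerivWithinAt (fun s => z s k) (dz t k) (Icc 0 T) t ∧
        HasDerivWithinAt (fun s => u s k) (du t k) (Icc 0 T) t) →
      (∀ t ∈ Icc (0 : ℝ) T,
        energy κ₂ (-(a / b)) N (z t - trunc N (Z t)) (u t - trunc N (U t)) ≤ 1 →
        ∀ k ∈ Finset.Icc (-(N : ℤ)) N, dz t k = fieldZ κ₁ lam a b (z t) (u t) k ∧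
          du t k = fieldU κ₂ lam (z t) (u t) k) →
      ∀ t ∈ Icc (0 : ℝ) T,
        energy κ₂ (-(a / b)) N (z t - trunc N (Z t)) (u t - trunc N (U t))
          ≤ (K + 1) * ((N : ℝ) ^ (1 - μ)) ^ 2 * Real.exp ((K + 1) * T) := by
  obtain ⟨K, hK0, hK⟩ := exists_energy_estimate (κ₁ := κ₁) (lam := lam) hκ₂ ha hb hμ hM
  refine ⟨K, hK0, fun Z U hex N hN hsmall z u dz du hsupp hsymm hinit hderiv hfield => ?_⟩
  have hN0 : (0 : ℝ) < N := by exact_mod_cast hN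
  refine le_of_deriv_le_of_le_one hK0 (by positivity) (fun t ht => hasDerivWithinAt_energy
    (fun k hk => hasDerivWithinAt_sub_trunc hk (hderiv t ht k hk).1 (hex.deriv_Z t ht k))
    (fun k hk => hasDerivWithinAt_sub_trunc hk (hderiv t ht k hk).2 (hex.deriv_U t ht k))) ?_ ?_ hsmall
  · have h0 : (0 : ℝ) ∈ Icc 0 T := left_mem_Icc.2 hT.le
    unfold energy
    rw [Finset.sum_eq_zero, Finset.sum_eq_zero]
    · simp
    · intro k hk
      rw [Pi.sub_apply, trunc, if_pos hk, (hinit k hk).2]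
      simp
    · intro k hk
      rw [Pi.sub_apply, trunc, if_pos hk, (hinit k hk).1]
      simp
  · intro t ht hE
    have hoff : ∀ (x X : ℤ → ℂ) k, k ∉ Finset.Icc (-(N : ℤ)) N → x k = 0 →
        (x - trunc N X) k = 0 := fun x X k hk hx => by
      rw [Pi.sub_apply, trunc, if_neg hk, hx, sub_zero]
    have h := hK N hN (Z t) (U t) (z t - trunc N (Z t)) (u t - trunc N (U t)) (hex.bound t ht).1
      (hex.bound t ht).2 (fun k => (hex.symm t ht k).2) (fun k => ?_)
      (fun k hk => hoff _ _ k hk (hsupp t ht k hk).1) (fun k hk => hoff _ _ k hk (hsupp t ht k hk).2) hE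
    · rw [sub_add_cancel, sub_add_cancel] at h
      refine le_trans (le_of_eq ?_) h
      have f := hfield t ht hE
      congr 3
      · congr 1
        exact Finset.sum_congr rfl fun k hk => by rw [(f k hk).1]
      · congr 1
        exact Finset.sum_congr rfl fun k hk => by rw [(f k hk).2]
    · rw [Pi.sub_apply, Pi.sub_apply, map_sub, hsymm t ht,
        trunc_symm fun k => (hex.symm t ht k).2]

theorem extend_restrict_eq_trunc (N : ℕ) (a : ℤ → ℂ) : extend (restrict N a) = trunc N a := by
  funext k
  by_cases h : k ∈ Finset.Icc (-(N : ℤ)) N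
  · rw [extend_of_mem _ h, restrict, trunc, if_pos h]
  · rw [extend_of_notMem _ h, trunc, if_neg h]

theorem extend_symmetrize_restrict {N : ℕ} {a : ℤ → ℂ} (ha : ∀ k, a (-k) = (starRingEnd ℂ) (a k)) :
    extend (symmetrize N (restrict N a)) = trunc N a := by
  rw [extend_symmetrize_of_symm, extend_restrict_eq_trunc]
  rw [extend_restrict_eq_trunc]
  exact trunc_symm ha N

theorem norm_modes_le {N : ℕ} {y : Modes N} {r : ℝ} (hr : 0 ≤ r) (h : ∀ k, ‖extend y k‖ ≤ r) :
    ‖y‖ ≤ r :=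
  (pi_norm_le_iff_of_nonneg hr).2 fun k => by
    have := h k
    rwa [extend_of_mem _ k.2] at this

/-- For small `N^{1-μ}` the system of modes has a solution on the whole interval. -/
theorem exists_isModeSolution {κ₁ κ₂ lam a b μ M T : ℝ} (hκ₂ : 0 < κ₂) (ha : a < 0) (hb : 0 < b)
    (hμ : 3 / 2 < μ) (hM : 0 ≤ M) (hT : 0 < T) :
    ∃ K : ℝ, 0 ≤ K ∧ ∀ Z U : ℝ → ℤ → ℂ, IsExactModes κ₁ κ₂ lam a b μ M T Z U → ∀ N : ℕ, 1 ≤ N →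
      (K + 1) * ((N : ℝ) ^ (1 - μ)) ^ 2 * Real.exp ((K + 1) * T) ≤ 1 →
      (∃ z u, IsModeSolution κ₁ κ₂ lam a b T (Z 0) (U 0) N z u) ∧
      ∀ z u, IsModeSolution κ₁ κ₂ lam a b T (Z 0) (U 0) N z u → ∀ t ∈ Icc (0 : ℝ) T,
        energy κ₂ (-(a / b)) N (z t - trunc N (Z t)) (u t - trunc N (U t))
          ≤ (K + 1) * ((N : ℝ) ^ (1 - μ)) ^ 2 * Real.exp ((K + 1) * T) := by
  obtain ⟨K, hK0, hK⟩ := exists_energy_le (κ₁ := κ₁) (lam := lam) hκ₂ ha hb hμ hM hT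
  refine ⟨K, hK0, fun Z U hex N hN hsmall => ⟨?_, fun z u h => ?_⟩⟩
  swap
  · exact hK Z U hex N hN hsmall z u _ _ h.supp (fun t ht k => (h.symm t ht k).2) h.init
      (fun t ht k hk => ⟨h.deriv_z t ht k hk, h.deriv_u t ht k hk⟩) fun t ht _ k hk => ⟨rfl, rfl⟩
  have hα : 0 < -(a / b) := by rw [← neg_div]; exact div_pos (neg_pos.2 ha) hb
  have h0 : (0 : ℝ) ∈ Icc 0 T := left_mem_Icc.2 hT.le
  set c := Real.sqrt (1 / κ₂ + 1 / -(a / b)) with hc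
  have hc0 : 0 ≤ c := Real.sqrt_nonneg _
  -- While the energy is at most one, each mode of the error is at most `c` and each mode of the
  -- exact solution at most `M`; inside this radius the cut-off is inactive. The `1` ensures
  -- positivity.
  have hr : 0 < c + M + 1 := by positivity
  obtain ⟨G, KG, L, hG, hL, hGF⟩ := exists_cutoff (contDiff_modeField κ₁ κ₂ lam a b N) hr
  -- The equation `y' = G (R y)` is solved and `R y` is kept. Its values are real by construction,
  -- so no symmetry of the cut-off field `G` is required.
  let R : Modes N × Modes N →L[ℝ] Modes N × Modes N := (symmetrize N).prodMap (symmetrize N)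
  obtain ⟨y, hy0, hy⟩ := exists_solution_of_lipschitz (G := fun y => G (R y))
    (hG.comp R.lipschitz) (fun y => hL _) hT.le (restrict N (Z 0), restrict N (U 0))
  have hRy : ∀ t ∈ Icc (0 : ℝ) T, HasDerivWithinAt (fun t => R (y t)) (R (G (R (y t)))) (Icc 0 T) t :=
    fun t ht => R.hasFDerivAt.comp_hasDerivWithinAt t (hy t ht)
  set z : ℝ → ℤ → ℂ := fun t => extend (R (y t)).1 with hz
  set u : ℝ → ℤ → ℂ := fun t => extend (R (y t)).2 with hu
  have hsupp : ∀ t ∈ Icc (0 : ℝ) T, ∀ k ∉ Finset.Icc (-(N : ℤ)) N, z t k = 0 ∧ u t k = 0 :=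
    fun t _ k hk => ⟨extend_of_notMem _ hk, extend_of_notMem _ hk⟩
  have hsymm : ∀ t ∈ Icc (0 : ℝ) T, ∀ k,
      z t (-k) = (starRingEnd ℂ) (z t k) ∧ u t (-k) = (starRingEnd ℂ) (u t k) :=
    fun t _ k => ⟨extend_symmetrize_neg _ k, extend_symmetrize_neg _ k⟩
  have hinit : ∀ k ∈ Finset.Icc (-(N : ℤ)) N, z 0 k = Z 0 k ∧ u 0 k = U 0 k := by
    intro k hk
    have e1 : z 0 = trunc N (Z 0) := by
      rw [hz]; simp only [hy0]
      exact extend_symmetrize_restrict fun k => (hex.symm 0 h0 k).1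
    have e2 : u 0 = trunc N (U 0) := by
      rw [hu]; simp only [hy0]
      exact extend_symmetrize_restrict fun k => (hex.symm 0 h0 k).2
    rw [e1, e2, trunc, trunc, if_pos hk, if_pos hk]
    exact ⟨rfl, rfl⟩
  have hderiv : ∀ t ∈ Icc (0 : ℝ) T, ∀ k ∈ Finset.Icc (-(N : ℤ)) N,
      HasDerivWithinAt (fun s => z s k) (extend (R (G (R (y t)))).1 k) (Icc 0 T) t ∧
      HasDerivWithinAt (fun s => u s k) (extend (R (G (R (y t)))).2 k) (Icc 0 T) t := by
    intro t ht k hk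
    simp only [hz, hu, extend_of_mem _ hk]
    exact ⟨hasDerivWithinAt_pi.1 (hRy t ht).fst ⟨k, hk⟩, hasDerivWithinAt_pi.1 (hRy t ht).snd ⟨k, hk⟩⟩
  have hfield : ∀ t ∈ Icc (0 : ℝ) T,
      energy κ₂ (-(a / b)) N (z t - trunc N (Z t)) (u t - trunc N (U t)) ≤ 1 →
      ∀ k ∈ Finset.Icc (-(N : ℤ)) N,
        extend (R (G (R (y t)))).1 k = fieldZ κ₁ lam a b (z t) (u t) k ∧
        extend (R (G (R (y t)))).2 k = fieldU κ₂ lam (z t) (u t) k := by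
    intro t ht hE k hk
    have hoff : ∀ (x X : ℤ → ℂ) k, k ∉ Finset.Icc (-(N : ℤ)) N → x k = 0 →
        (x - trunc N X) k = 0 := fun x X k hk hx => by
      rw [Pi.sub_apply, trunc, if_neg hk, hx, sub_zero]
    obtain ⟨-, b1, b2⟩ := energy_bounds hκ₂ hα (N := N) (θ := z t - trunc N (Z t))
      (ξ := u t - trunc N (U t)) (fun k hk => hoff _ _ k hk (hsupp t ht k hk).1)
      (fun k hk => hoff _ _ k hk (hsupp t ht k hk).2)
    have hsc := mul_le_of_le_one_right hc0 (Real.sqrt_le_one.2 hE)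
    rw [← hc] at b1 b2
    have hμ0 : 0 ≤ μ := by linarith
    have bound : ∀ {x X : ℤ → ℂ}, SobBd μ X M → L2Bd (x - trunc N X) (c * Real.sqrt
        (energy κ₂ (-(a / b)) N (z t - trunc N (Z t)) (u t - trunc N (U t)))) →
        ∀ k, ‖x k‖ ≤ c + M + 1 := by
      intro x X hX hx k
      have e : x k = (x - trunc N X) k + trunc N X k := by simp
      rw [e]
      have h1 := hx.norm_le k
      have h2 := ((hX.trunc N).l2 hμ0).norm_le k
      linarith [norm_add_le ((x - trunc N X) k) (trunc N X k)]
    have hnorm : ‖R (y t)‖ ≤ c + M + 1 := by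
      rw [Prod.norm_def]
      exact max_le (norm_modes_le hr.le (bound (hex.bound t ht).1 b1))
        (norm_modes_le hr.le (bound (hex.bound t ht).2 b2))
    rw [hGF _ hnorm]
    have sz := fun k => (hsymm t ht k).1
    have su := fun k => (hsymm t ht k).2
    constructor
    · have := congrFun (extend_symmetrize_restrict (N := N) (fieldZ_neg_index sz su κ₁ lam a b)) k
      rw [trunc, if_pos hk] at this
      exact this
    · have := congrFun (extend_symmetrize_restrict (N := N) (fieldU_neg_index sz su κ₂ lam)) k
      rw [trunc, if_pos hk] at this
      exact this
  -- The field is the true one only while the energy is at most one, which is all the energy bound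
  -- asks. The bound then keeps the energy below one on `[0, T]`, so the uncut equations hold
  -- throughout.
  have hle := hK Z U hex N hN hsmall z u _ _ hsupp (fun t ht k => (hsymm t ht k).2) hinit hderiv hfield
  refine ⟨z, u, hsupp, hsymm, fun t ht k hk => ?_, fun t ht k hk => ?_, hinit⟩
  · rw [← (hfield t ht ((hle t ht).trans hsmall) k hk).1]
    exact (hderiv t ht k hk).1
  · rw [← (hfield t ht ((hle t ht).trans hsmall) k hk).2]
    exact (hderiv t ht k hk).2

/-! ### From the energy to the `L²` error -/

/-- Parseval applied to the splitting into the discrete error `f - P g` and the projection error `P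
g - g`. -/
theorem l2norm_sub_le {N : ℕ} {f : C(UnitAddCircle, ℂ)}
    (g : Lp ℝ 2 (AddCircle.haarAddCircle (T := 1))) {A B : ℝ}
    (hA : L2Bd (fourierCoeff f - trunc N (coeff g)) A) (hB : L2Bd (coeff g - trunc N (coeff g)) B) :
    l2norm (fun x => f x - (g x : ℂ)) ≤ A + B := by
  have h := l2norm_eq ((memLp_continuousMap f).sub (memLp_ofReal g))
  have hc : fourierCoeff (⇑f - fun x => (g x : ℂ))
      = (fourierCoeff f - trunc N (coeff g)) + -(coeff g - trunc N (coeff g)) := by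
    funext k
    have : fourierCoeff (⇑f - fun x => (g x : ℂ)) k = fourierCoeff f k - coeff g k := by
      unfold coeff fourierCoeff
      rw [← integral_sub]
      · exact integral_congr_ae (Filter.Eventually.of_forall fun x => smul_sub _ _ _)
      · exact (integrable_continuousMap f).fourier_smul _
      · exact ((memLp_ofReal g).integrable (by norm_num)).fourier_smul _
    rw [this]
    simp
  rw [hc] at h
  have hAB := hA.add hB.neg
  refine h.2.trans_le (Real.sqrt_le_iff.2 ⟨hAB.1, h.1.tsum_le_of_sum_le hAB.2⟩)

theorem sobBd_coeff {μ M : ℝ} (hM : 0 ≤ M) {g : PerSobolev μ} (hg : ‖g‖ ≤ M) : SobBd μ (coeff g) M :=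
  ⟨hM, fun F => (sum_weight_le g F).trans (pow_le_pow_left₀ (norm_nonneg _) hg 2)⟩

theorem IsSolution.isExactModes {κ₁ κ₂ lam a b T μ M : ℝ} (hb : 0 < b) (hμ : 0 ≤ μ) (hM : 0 ≤ M)
    {ζ u : ℝ → PerSobolev μ} (h : IsSolution κ₁ κ₂ lam a b 0 0 T ζ u)
    (hζ : ContDiffOn ℝ 1 ζ (Icc 0 T)) (hu : ContDiffOn ℝ 1 u (Icc 0 T))
    (hζM : ∀ t ∈ Icc (0 : ℝ) T, ‖ζ t‖ ≤ M) (huM : ∀ t ∈ Icc (0 : ℝ) T, ‖u t‖ ≤ M) :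
    IsExactModes κ₁ κ₂ lam a b μ M T (fun t => coeff (ζ t)) (fun t => coeff (u t)) where
  bound t ht := ⟨sobBd_coeff hM (hζM t ht), sobBd_coeff hM (huM t ht)⟩
  symm t _ k := ⟨coeff_neg_index _ k, coeff_neg_index _ k⟩
  deriv_Z t ht k := by
    rw [← (h.coeff_eq hb ht k).1]
    exact hasDerivWithinAt_coeff hμ hζ ht k
  deriv_U t ht k := by
    rw [← (h.coeff_eq hb ht k).2]
    exact hasDerivWithinAt_coeff hμ hu ht k

/-- The error in terms of the energy of the discrete part of the error. -/
theorem error_le {κ₁ κ₂ lam a b μ M T : ℝ} (hκ₂ : 0 < κ₂) (ha : a < 0) (hb : 0 < b)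
    (hμ : 3 / 2 < μ) {ζ u : PerSobolev μ} (hζ : SobBd μ (coeff ζ) M) (hu : SobBd μ (coeff u) M)
    {z₀ u₀ : ℤ → ℂ} {N : ℕ} (hN : 1 ≤ N) {ζN uN : ℝ → C(UnitAddCircle, ℂ)}
    (h : IsModeSolution κ₁ κ₂ lam a b T z₀ u₀ N (fun t => fourierCoeff (ζN t))
      (fun t => fourierCoeff (uN t))) {t : ℝ} (ht : t ∈ Icc (0 : ℝ) T) {Q : ℝ}
    (hQ : energy κ₂ (-(a / b)) N (fourierCoeff (ζN t) - trunc N (coeff ζ))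
      (fourierCoeff (uN t) - trunc N (coeff u)) ≤ Q) :
    l2norm (fun x => ζN t x - (ζ x : ℂ)) + l2norm (fun x => uN t x - (u x : ℂ))
      ≤ 2 * (Real.sqrt (1 / κ₂ + 1 / -(a / b)) * Real.sqrt Q + 2 * Real.pi * M * (N : ℝ) ^ (1 - μ)) := by
  have hα : 0 < -(a / b) := by rw [← neg_div]; exact div_pos (neg_pos.2 ha) hb
  have hoff : ∀ (x X : ℤ → ℂ) k, k ∉ Finset.Icc (-(N : ℤ)) N → x k = 0 →
      (x - trunc N X) k = 0 := fun x X k hk hx => by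
    rw [Pi.sub_apply, trunc, if_neg hk, hx, sub_zero]
  obtain ⟨-, b1, b2⟩ := energy_bounds hκ₂ hα (N := N)
    (θ := fourierCoeff (ζN t) - trunc N (coeff ζ)) (ξ := fourierCoeff (uN t) - trunc N (coeff u))
    (fun k hk => hoff _ _ k hk (h.supp t ht k hk).1) (fun k hk => hoff _ _ k hk (h.supp t ht k hk).2)
  have hs := mul_le_mul_of_nonneg_left (Real.sqrt_le_sqrt hQ)
    (Real.sqrt_nonneg (1 / κ₂ + 1 / -(a / b)))
  have hμ1 : 1 ≤ μ := by linarith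
  have e1 := l2norm_sub_le ζ.toL2 (b1.mono_right hs) (hζ.tail hμ1 hN).of_wt
  have e2 := l2norm_sub_le u.toL2 (b2.mono_right hs) (hu.tail hμ1 hN).of_wt
  rw [two_mul]
  exact add_le_add e1 e2

theorem eventually_small {μ : ℝ} (hμ : 1 < μ) (Q : ℝ) :
    ∃ N₀ : ℕ, ∀ N, N₀ ≤ N → Q * ((N : ℝ) ^ (1 - μ)) ^ 2 ≤ 1 := by
  have h1 : Filter.Tendsto (fun N : ℕ => (N : ℝ) ^ (1 - μ)) Filter.atTop (nhds 0) := by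
    have := (tendsto_rpow_neg_atTop (y := μ - 1) (by linarith)).comp tendsto_natCast_atTop_atTop
    simpa [Function.comp_def] using this
  have h2 := (h1.pow 2).const_mul Q
  have h3 := h2.eventually_le_const (u := 1) (by norm_num)
  exact Filter.eventually_atTop.1 h3

theorem semidiscrete_unique {κ₁ κ₂ lam a b T : ℝ} {ζ₀ u₀ : UnitAddCircle → ℝ} {N : ℕ}
    {ζN uN ζN' uN' : ℝ → C(UnitAddCircle, ℂ)}
    (h : IsSemidiscreteSolution κ₁ κ₂ lam a b T ζ₀ u₀ N ζN uN)
    (h' : IsSemidiscreteSolution κ₁ κ₂ lam a b T ζ₀ u₀ N ζN' uN') {t : ℝ} (ht : t ∈ Icc (0 : ℝ) T) :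
    ζN t = ζN' t ∧ uN t = uN' t := by
  have e := h.isModeSolution.unique h'.isModeSolution ht
  rw [eq_tp_of_mem (h.mem_S t ht).1, eq_tp_of_mem (h'.mem_S t ht).1,
    eq_tp_of_mem (h.mem_S t ht).2, eq_tp_of_mem (h'.mem_S t ht).2, e.1, e.2]
  exact ⟨rfl, rfl⟩

end PeriodicBoussinesq

/-! ### Assembly of the theorem -/

theorem mainTheorem7
    (κ₁ κ₂ lam a b : ℝ) (hκ₁ : 0 < κ₁) (hκ₂ : 0 < κ₂) (ha : a < 0) (hb : 0 < b)
    (μ : ℝ) (hμ : 3 / 2 < μ) (T : ℝ) (hT : 0 < T)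
    (ζ₀ u₀ : PeriodicBoussinesq.PerSobolev μ)
    (ζ u : ℝ → PeriodicBoussinesq.PerSobolev μ)
    (hζ : ContDiffOn ℝ 1 ζ (Set.Icc 0 T)) (hu : ContDiffOn ℝ 1 u (Set.Icc 0 T))
    (hsol : PeriodicBoussinesq.IsSolution κ₁ κ₂ lam a b 0 0 T ζ u)
    (hζ₀ : ζ 0 = ζ₀) (hu₀ : u 0 = u₀) :
    ∃ C : ℝ, 0 < C ∧ ∃ N₀ : ℕ,
      (∀ N : ℕ, N₀ ≤ N → ∃ ζN uN : ℝ → C(UnitAddCircle, ℂ),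
        PeriodicBoussinesq.IsSemidiscreteSolution κ₁ κ₂ lam a b T ζ₀ u₀ N ζN uN) ∧
      (∀ N : ℕ, 1 ≤ N → ∀ ζN uN ζN' uN' : ℝ → C(UnitAddCircle, ℂ),
        PeriodicBoussinesq.IsSemidiscreteSolution κ₁ κ₂ lam a b T ζ₀ u₀ N ζN uN →
        PeriodicBoussinesq.IsSemidiscreteSolution κ₁ κ₂ lam a b T ζ₀ u₀ N ζN' uN' →
        ∀ t ∈ Set.Icc (0 : ℝ) T, ζN t = ζN' t ∧ uN t = uN' t) ∧
      (∀ N : ℕ, 1 ≤ N → ∀ ζN uN : ℝ → C(UnitAddCircle, ℂ),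
        PeriodicBoussinesq.IsSemidiscreteSolution κ₁ κ₂ lam a b T ζ₀ u₀ N ζN uN →
        ∀ t ∈ Set.Icc (0 : ℝ) T,
          PeriodicBoussinesq.l2norm (fun x => ζN t x - (ζ t x : ℂ))
            + PeriodicBoussinesq.l2norm (fun x => uN t x - (u t x : ℂ))
            ≤ C * (N : ℝ) ^ (1 - μ)) := by
  open PeriodicBoussinesq in
  subst hζ₀ hu₀
  obtain ⟨M₁, hM₁⟩ := isCompact_Icc.exists_bound_of_continuousOn hζ.continuousOn
  obtain ⟨M₂, hM₂⟩ := isCompact_Icc.exists_bound_of_continuousOn hu.continuousOn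
  set M := max (max M₁ M₂) 0 with hMdef
  have hM : 0 ≤ M := le_max_right _ _
  have hex := hsol.isExactModes hb (by linarith) hM hζ hu
    (fun t ht => (hM₁ t ht).trans ((le_max_left _ _).trans (le_max_left _ _)))
    (fun t ht => (hM₂ t ht).trans ((le_max_right _ _).trans (le_max_left _ _)))
  obtain ⟨K, hK0, hK⟩ := exists_isModeSolution (κ₁ := κ₁) (lam := lam) hκ₂ ha hb hμ hM hT
  obtain ⟨N₁, hN₁⟩ := eventually_small (μ := μ) (by linarith) ((K + 1) * Real.exp ((K + 1) * T))
  have hsmall : ∀ N, N₁ ≤ N → (K + 1) * ((N : ℝ) ^ (1 - μ)) ^ 2 * Real.exp ((K + 1) * T) ≤ 1 :=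
    fun N hN => by rw [mul_right_comm]; exact hN₁ N hN
  set c := Real.sqrt (1 / κ₂ + 1 / -(a / b)) with hc
  have hc0 : 0 ≤ c := Real.sqrt_nonneg _
  set D := 2 * (c * Real.sqrt ((K + 1) * Real.exp ((K + 1) * T)) + 2 * Real.pi * M) with hD
  have hD0 : 0 ≤ D := by positivity
  have hpow : ∀ N : ℕ, 1 ≤ N → 0 < (N : ℝ) ^ (1 - μ) := fun N hN =>
    Real.rpow_pos_of_pos (by exact_mod_cast hN) _
  -- For small `N` the barrier argument is unavailable, but the estimate is claimed whenever a
  -- solution exists. A constant depending on `N` suffices, since finitely many `N` are concerned.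
  have hlow : ∀ N : ℕ, ∃ CN : ℝ, 0 ≤ CN ∧ (1 ≤ N → ∀ ζN uN : ℝ → C(UnitAddCircle, ℂ),
      IsSemidiscreteSolution κ₁ κ₂ lam a b T (ζ 0) (u 0) N ζN uN → ∀ t ∈ Icc (0 : ℝ) T,
        l2norm (fun x => ζN t x - (ζ t x : ℂ)) + l2norm (fun x => uN t x - (u t x : ℂ))
          ≤ CN * (N : ℝ) ^ (1 - μ)) := by
    intro N
    by_cases hN : 1 ≤ N
    swap
    · exact ⟨0, le_rfl, fun h => absurd h hN⟩
    by_cases hS : ∃ ζN uN, IsSemidiscreteSolution κ₁ κ₂ lam a b T (ζ 0) (u 0) N ζN uN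
    swap
    · exact ⟨0, le_rfl, fun _ ζN uN h => absurd ⟨ζN, uN, h⟩ hS⟩
    obtain ⟨ζN, uN, hS⟩ := hS
    have hm := hS.isModeSolution
    -- The energy of one solution is continuous on `[0, T]`, hence bounded; by uniqueness the bound
    -- serves every solution for this `N`.
    have hcont : ContinuousOn (fun t => energy κ₂ (-(a / b)) N
        (fourierCoeff (ζN t) - trunc N (coeff (ζ t))) (fourierCoeff (uN t) - trunc N (coeff (u t))))
        (Icc 0 T) := fun t ht => (hasDerivWithinAt_energy
      (fun k hk => hasDerivWithinAt_sub_trunc hk (hm.deriv_z t ht k hk) (hex.deriv_Z t ht k))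
      (fun k hk => hasDerivWithinAt_sub_trunc hk (hm.deriv_u t ht k hk)
        (hex.deriv_U t ht k))).continuousWithinAt
    obtain ⟨Q, hQ⟩ := isCompact_Icc.exists_bound_of_continuousOn hcont
    refine ⟨2 * (c * Real.sqrt Q + 2 * Real.pi * M * (N : ℝ) ^ (1 - μ)) / (N : ℝ) ^ (1 - μ),
      by positivity, fun _ ζN' uN' hS' t ht => ?_⟩
    rw [div_mul_cancel₀ _ (hpow N hN).ne']
    obtain ⟨e1, e2⟩ := semidiscrete_unique hS' hS ht
    rw [e1, e2]
    exact error_le hκ₂ ha hb hμ (hex.bound t ht).1 (hex.bound t ht).2 hN hm ht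
      ((le_abs_self _).trans (hQ t ht))
  choose CN hCN0 hCN using hlow
  have hsum0 : 0 ≤ ∑ n ∈ Finset.range N₁, CN n := Finset.sum_nonneg fun n _ => hCN0 n
  -- `D` covers `N ≥ N₁`, the sum dominates each `CN n` with `n < N₁`, and the `1` makes the
  -- constant strictly positive. The maximum with `1` excludes `N = 0`.
  refine ⟨D + ∑ n ∈ Finset.range N₁, CN n + 1, by positivity, max N₁ 1, ?_, ?_, ?_⟩
  · intro N hN
    obtain ⟨z, v, h⟩ := (hK _ _ hex N ((le_max_right _ _).trans hN)
      (hsmall N ((le_max_left _ _).trans hN))).1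
    exact ⟨_, _, h.isSemidiscreteSolution hT⟩
  · intro N _ ζN uN ζN' uN' h h' t ht
    exact semidiscrete_unique h h' ht
  · intro N hN ζN uN h t ht
    rcases lt_or_ge N N₁ with hlt | hge
    · refine (hCN N hN ζN uN h t ht).trans (mul_le_mul_of_nonneg_right ?_ (hpow N hN).le)
      have := Finset.single_le_sum (f := CN) (fun n _ => hCN0 n) (Finset.mem_range.2 hlt)
      linarith
    · have hm := h.isModeSolution
      have hE := (hK _ _ hex N hN (hsmall N hge)).2 _ _ hm t ht
      refine (error_le hκ₂ ha hb hμ (hex.bound t ht).1 (hex.bound t ht).2 hN hm ht hE).trans ?_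
      have e : Real.sqrt ((K + 1) * ((N : ℝ) ^ (1 - μ)) ^ 2 * Real.exp ((K + 1) * T))
          = Real.sqrt ((K + 1) * Real.exp ((K + 1) * T)) * (N : ℝ) ^ (1 - μ) := by
        rw [mul_right_comm, Real.sqrt_mul (by positivity), Real.sqrt_sq (hpow N hN).le]
      rw [e, ← hc]
      calc _ = D * (N : ℝ) ^ (1 - μ) := by rw [hD]; ring
        _ ≤ _ := mul_le_mul_of_nonneg_right (by linarith) (hpow N hN).le
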